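/- Let $D\subset\mathbb{R}^d$ be an open set with Lipschitz boundary (near each boundary point, in suitable orthonormal coordinates, $D$ is the strict subgraph of a Lipschitz function). For $t>0$ let $D(t)=\{x\in D:\operatorname{dist}(x,\partial D)>t\}$, with $\operatorname{dist}(x,\emptyset)=+\infty$. Let $\{w_\varepsilon\}_{\varepsilon>0}$ be a family of real functions bounded in $L^2(D)$, and assume that for some $k>0$, $r>0$ and $C<\infty$ $$\int_{D(k\varepsilon)}\int_{\{|\xi|\le r\}}\Bigl(\frac{w_\varepsilon(x+\varepsilon\xi)-w_\varepsilon(x)}{\varepsilon}\Bigr)^2\,d\xi\,dx\le C\qquad\text{for all }\varepsilon>0,$$ where the inner integral is taken over those $\xi$ with $x+\varepsilon\xi\in D$ (which is automatic if $r\le k$). Let $\varepsilon_j>0$ with $\varepsilon_j\to0$ as $j\to\infty$. Then: 1. For every open $D'\Subset D$ (that is, $\overline{D'}$ is compact and contained in $D$) the set $\{w_{\varepsilon_j}|_{D'}\}_{j\in\mathbb{N}}$ is relatively compact in $L^2(D')$, and every limit point in $L^2(D')$ of the sequence $(w_{\varepsilon_j}|_{D'})_j$ is the restriction to $D'$ of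 a function in $H^1(D)$. 2. If a subsequence of $(w_{\varepsilon_j})_j$ converges to $u$ in $L^2_{\rm loc}(D)$, i.e. in $L^2(D')$ for every open $D'\Subset D$, then $u\in H^1(D)$. Here $H^1(D)$ is the space of $u\in L^2(D)$ whose weak first partial derivatives in $D$ exist and belong to $L^2(D)$. -/

import Mathlib

open MeasureTheory Filter Topology
open scoped ENNReal NNReal ContDiff

noncomputable section

/-- `D` has Lipschitz boundary: near each boundary point, in suitable orthonormal coordinates,
`D` is the strict subgraph of a Lipschitz function. Here `ν` is the vertical direction and the
function `g` is defined on the hyperplane orthogonal to `ν`. -/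
def HasLipschitzBoundary {d : ℕ} (D : Set (EuclideanSpace ℝ (Fin d))) : Prop :=
  ∀ x ∈ frontier D, ∃ ν : EuclideanSpace ℝ (Fin d), ‖ν‖ = 1 ∧
    ∃ (g : (Submodule.span ℝ {ν})ᗮ → ℝ) (L : ℝ≥0), LipschitzWith L g ∧
      ∃ U ∈ 𝓝 x, ∀ y ∈ U,
        (y ∈ D ↔ inner ℝ ν y < g ((Submodule.span ℝ {ν})ᗮ.orthogonalProjectionOnto y))

/-- `D(t)`, the set of points of `D` at distance greater than `t` from the boundary of `D`.
The distance is extended-valued, so that the distance to the empty set is `∞` and, for the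
whole space, `D(t) = D`. -/
def innerPart {d : ℕ} (D : Set (EuclideanSpace ℝ (Fin d))) (t : ℝ) :
    Set (EuclideanSpace ℝ (Fin d)) :=
  {x ∈ D | ENNReal.ofReal t < Metric.infEDist x (frontier D)}

/-- The convolution energy
`∫_{D(σ)} ∫_{|ξ| ≤ r} ((w (x + ε ξ) - w x) / ε)² dξ dx`, with values in `[0, ∞]`.
The function `w` is only meaningful on `D`, so only those `ξ` with `x + ε ξ ∈ D` are taken
into account; this is no restriction when `ε r ≤ σ`. -/
def convEnergy {d : ℕ} (D : Set (EuclideanSpace ℝ (Fin d))) (ε σ r : ℝ)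
    (w : EuclideanSpace ℝ (Fin d) → ℝ) : ℝ≥0∞ :=
  ∫⁻ x in innerPart D σ, ∫⁻ ξ in {ξ | ‖ξ‖ ≤ r ∧ x + ε • ξ ∈ D},
    ENNReal.ofReal (((w (x + ε • ξ) - w x) / ε) ^ 2)

/-- `D' ⋐ D`: the closure of `D'` is compact and contained in `D`. -/
def CompactlyContained {d : ℕ} (D' D : Set (EuclideanSpace ℝ (Fin d))) : Prop :=
  IsCompact (closure D') ∧ closure D' ⊆ D

theorem CompactlyContained.subset {d : ℕ} {D' D : Set (EuclideanSpace ℝ (Fin d))}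
    (h : CompactlyContained D' D) : D' ⊆ D :=
  subset_closure.trans h.2

/-- The restriction to `D' ⊆ D` of a function in `L²(D)`, as an element of `L²(D')`. -/
def restrictL2 {d : ℕ} {D D' : Set (EuclideanSpace ℝ (Fin d))}
    {w : EuclideanSpace ℝ (Fin d) → ℝ} (hw : MemLp w 2 (volume.restrict D)) (h : D' ⊆ D) :
    Lp ℝ 2 (volume.restrict D') :=
  (hw.mono_measure (Measure.restrict_mono h le_rfl)).toLp w

/-- `g` is the `i`-th weak partial derivative of `u` in `D`. -/
def IsWeakPartialDeriv {d : ℕ} (D : Set (EuclideanSpace ℝ (Fin d))) (i : Fin d)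
    (u g : EuclideanSpace ℝ (Fin d) → ℝ) : Prop :=
  ∀ φ : EuclideanSpace ℝ (Fin d) → ℝ, ContDiff ℝ ∞ φ → HasCompactSupport φ → tsupport φ ⊆ D →
    ∫ x in D, u x * fderiv ℝ φ x (EuclideanSpace.single i 1) = -∫ x in D, g x * φ x

/-- `u ∈ H¹(D)`: `u ∈ L²(D)` and its weak partial derivatives exist and are in `L²(D)`. -/
def MemH1 {d : ℕ} (D : Set (EuclideanSpace ℝ (Fin d)))
    (u : EuclideanSpace ℝ (Fin d) → ℝ) : Prop :=
  MemLp u 2 (volume.restrict D) ∧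
    ∀ i : Fin d, ∃ g : EuclideanSpace ℝ (Fin d) → ℝ,
      MemLp g 2 (volume.restrict D) ∧ IsWeakPartialDeriv D i u g

end

/-! ### Weak and strong convergence in `L²`. -/

section SquareIntegrable

variable {α : Type*} [MeasurableSpace α] {μ : Measure α}

/-! A bounded sequence in `L²(D)` has a subsequence converging weakly to some `u`. The energy bound
is used twice: to show that `u` is in `H¹(D)`, and to make the convergence strong on compactly
contained sets.

Regularity (`memH1_of_tendstoWeakL2`). By Tonelli the energy is the integral over `ξ` of
`sliceEnergy`, so by Fatou the liminf of the slice energies is finite for almost every `ξ` in the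
ball of radius `r`. For such `ξ`, discrete integration by parts against a test function `φ` and
passage to the limit give `|∫ u ∂_ξ φ| ≤ c ‖φ‖`. The directions with such a bound form a linear
subspace; a proper subspace is null, so every direction is admissible, and Riesz representation
produces the weak derivatives.

Compactness (`tendsto_eLpNorm_sub_of_tendstoWeakL2`). A shift by `Nεξ` is a chain of `N` shifts by
`εξ`. With `Nε` comparable to a fixed `δ ≥ ε`, integration over `ξ` bounds the mean square of all
shifts of length at most `δr`, so `w` differs from its average over balls of radius `δr` by `O(δ)`
in `L²`, uniformly in `ε ≤ δ`. At fixed `δ` these averages are pairings with indicator functions;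
they converge pointwise by weak convergence, and in `L²` by bounded convergence. Hence the
subsequence is Cauchy. -/

theorem eLpNorm_two_sq_eq_lintegral (f : α → ℝ) :
    eLpNorm f 2 μ ^ 2 = ∫⁻ x, ENNReal.ofReal (f x ^ 2) ∂μ := by
  rw [eLpNorm_eq_lintegral_rpow_enorm_toReal two_ne_zero ENNReal.ofNat_ne_top, ← ENNReal.rpow_two,
    ← ENNReal.rpow_mul]
  simp only [ENNReal.toReal_ofNat, one_div, isUnit_iff_ne_zero, ne_eq, OfNat.ofNat_ne_zero,
    not_false_eq_true, IsUnit.inv_mul_cancel, ENNReal.rpow_ofNat, ENNReal.rpow_one]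
  refine lintegral_congr fun x => ?_
  rw [← sq_abs, ENNReal.ofReal_pow (abs_nonneg _), ← Real.enorm_eq_ofReal_abs]

theorem integrable_mul_of_memLp_two {f g : α → ℝ} (hf : MemLp f 2 μ) (hg : MemLp g 2 μ) :
    Integrable (fun x => f x * g x) μ :=
  hf.integrable_mul hg

/-- The Cauchy–Schwarz inequality for square integrable functions. -/
theorem abs_integral_mul_le_eLpNorm {f g : α → ℝ} (hf : MemLp f 2 μ) (hg : MemLp g 2 μ) :
    |∫ x, f x * g x ∂μ| ≤ (eLpNorm f 2 μ).toReal * (eLpNorm g 2 μ).toReal := by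
  have h := norm_inner_le_norm (𝕜 := ℝ) (hg.toLp g) (hf.toLp f)
  rw [L2.inner_def, Lp.norm_toLp, Lp.norm_toLp, mul_comm] at h
  convert h using 1
  rw [Real.norm_eq_abs]
  congr 1
  refine integral_congr_ae ?_
  filter_upwards [hf.coeFn_toLp, hg.coeFn_toLp] with x h1 h2
  simp [h1, h2]

theorem inner_toLp_eq_integral {f g : α → ℝ} (hf : MemLp f 2 μ) (hg : MemLp g 2 μ) :
    inner ℝ (hf.toLp f) (hg.toLp g) = ∫ x, f x * g x ∂μ := by
  rw [L2.inner_def]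
  refine integral_congr_ae ?_
  filter_upwards [hf.coeFn_toLp, hg.coeFn_toLp] with x h1 h2
  simp [h1, h2, mul_comm]

/-- `f n` converges to `u` weakly in `L²(μ)`. -/
def TendstoWeakL2 (μ : Measure α) (f : ℕ → α → ℝ) (u : α → ℝ) : Prop :=
  ∀ g : α → ℝ, MemLp g 2 μ →
    Tendsto (fun n => ∫ x, f n x * g x ∂μ) atTop (𝓝 (∫ x, u x * g x ∂μ))

/-- Bounded sequences in a separable `L²` space have weakly convergent subsequences. -/
theorem exists_subseq_tendstoWeakL2 [IsSeparable μ] {f : ℕ → α → ℝ}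
    (hf : ∀ n, MemLp (f n) 2 μ) {M : ℝ≥0} (hM : ∀ n, eLpNorm (f n) 2 μ ≤ M) :
    ∃ φ : ℕ → ℕ, StrictMono φ ∧ ∃ u : α → ℝ, MemLp u 2 μ ∧
      TendstoWeakL2 μ (fun n => f (φ n)) u := by
  have : Fact ((2 : ℝ≥0∞) ≠ ⊤) := ⟨by norm_num⟩
  -- Sequential Banach–Alaoglu, with `L²` identified with its dual by Riesz.
  have hc := WeakDual.isSeqCompact_closedBall ℝ (Lp ℝ 2 μ) 0 M
  let F : ℕ → WeakDual ℝ (Lp ℝ 2 μ) := fun n =>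
    StrongDual.toWeakDual (InnerProductSpace.toDual ℝ (Lp ℝ 2 μ) ((hf n).toLp (f n)))
  have hF : ∀ n, F n ∈ ⇑WeakDual.toStrongDual ⁻¹'
      Metric.closedBall (0 : StrongDual ℝ (Lp ℝ 2 μ)) M := by
    intro n
    have : ‖InnerProductSpace.toDual ℝ (Lp ℝ 2 μ) ((hf n).toLp (f n))‖ ≤ M := by
      rw [LinearIsometryEquiv.norm_map, Lp.norm_toLp]
      exact ENNReal.toReal_le_coe_of_le_coe (hM n)
    simpa [F] using this
  obtain ⟨a, -, φ, hφ, ha⟩ := hc hF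
  refine ⟨φ, hφ, (InnerProductSpace.toDual ℝ (Lp ℝ 2 μ)).symm (WeakDual.toStrongDual a),
    Lp.memLp _, fun g hg => ?_⟩
  have h1 := ((WeakDual.eval_continuous (𝕜 := ℝ) (hg.toLp g)).tendsto a).comp ha
  have h2 : a (hg.toLp g) = ∫ x,
      (InnerProductSpace.toDual ℝ (Lp ℝ 2 μ)).symm (WeakDual.toStrongDual a) x * g x ∂μ := by
    rw [← inner_toLp_eq_integral (Lp.memLp _) hg, Lp.toLp_coeFn,
      InnerProductSpace.toDual_symm_apply]
    rfl
  rw [h2] at h1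
  refine h1.congr fun n => ?_
  rw [← inner_toLp_eq_integral (hf _) hg]
  rfl

/-- A weakly convergent sequence may be tested against strongly convergent functions. -/
theorem TendstoWeakL2.tendsto_integral_mul {f : ℕ → α → ℝ} {u : α → ℝ}
    (h : TendstoWeakL2 μ f u) (hf : ∀ n, MemLp (f n) 2 μ) {M : ℝ≥0}
    (hM : ∀ n, eLpNorm (f n) 2 μ ≤ M) {g : ℕ → α → ℝ} {G : α → ℝ} (hg : ∀ n, MemLp (g n) 2 μ)
    (hG : MemLp G 2 μ) (hgG : Tendsto (fun n => eLpNorm (g n - G) 2 μ) atTop (𝓝 0)) :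
    Tendsto (fun n => ∫ x, f n x * g n x ∂μ) atTop (𝓝 (∫ x, u x * G x ∂μ)) := by
  have h1 : Tendsto (fun n => ∫ x, f n x * (g n - G) x ∂μ) atTop (𝓝 0) := by
    have h2 : Tendsto (fun n => (M : ℝ) * (eLpNorm (g n - G) 2 μ).toReal) atTop (𝓝 0) := by
      have := ((ENNReal.tendsto_toReal ENNReal.zero_ne_top).comp hgG).const_mul (M : ℝ)
      simpa using this
    refine squeeze_zero_norm (fun n => ?_) h2
    refine (abs_integral_mul_le_eLpNorm (hf n) ((hg n).sub hG)).trans ?_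
    gcongr
    exact ENNReal.toReal_le_coe_of_le_coe (hM n)
  have h3 := h1.add (h G hG)
  rw [zero_add] at h3
  refine h3.congr fun n => ?_
  rw [← integral_add (integrable_mul_of_memLp_two (hf n) ((hg n).sub hG))
    (integrable_mul_of_memLp_two (hf n) hG)]
  refine integral_congr_ae (.of_forall fun x => ?_)
  simp only [Pi.sub_apply]
  ring

/-- On a smaller set, strong and weak limits agree almost everywhere. -/
theorem TendstoWeakL2.ae_eq_of_tendsto {s t : Set α} (ht : MeasurableSet t) (hts : t ⊆ s)
    {f : ℕ → α → ℝ} {u v : α → ℝ} (h : TendstoWeakL2 (μ.restrict s) f u)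
    (hf : ∀ n, MemLp (f n) 2 (μ.restrict s)) (hu : MemLp u 2 (μ.restrict s))
    (hv : MemLp v 2 (μ.restrict t))
    (hlim : Tendsto (fun n => eLpNorm (f n - v) 2 (μ.restrict t)) atTop (𝓝 0)) :
    v =ᵐ[μ.restrict t] u := by
  have hst : μ.restrict t ≤ μ.restrict s := Measure.restrict_mono hts le_rfl
  have hut : MemLp u 2 (μ.restrict t) := hu.mono_measure hst
  have hd : MemLp (v - u) 2 (μ.restrict t) := hv.sub hut
  have hrest : (μ.restrict s).restrict t = μ.restrict t := Measure.restrict_restrict_of_subset hts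
  have hind : MemLp (t.indicator (v - u)) 2 (μ.restrict s) := by
    rw [memLp_indicator_iff_restrict ht, hrest]; exact hd
  have key : ∀ F : α → ℝ, ∫ x, F x * t.indicator (v - u) x ∂(μ.restrict s)
      = ∫ x, F x * (v - u) x ∂(μ.restrict t) := by
    intro F
    rw [← hrest, ← integral_indicator ht]
    refine integral_congr_ae (.of_forall fun x => ?_)
    by_cases hx : x ∈ t <;> simp [hx]
  -- Tested against `v - u` on `t`, the weak limit gives `∫ u (v - u)` and the strong limit `∫ v (v
  -- - u)`; equating them forces `∫ (v - u)² = 0`.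
  have h1 := h _ hind
  simp only [key] at h1
  have h2 : Tendsto (fun n => ∫ x, f n x * (v - u) x ∂(μ.restrict t)) atTop
      (𝓝 (∫ x, v x * (v - u) x ∂(μ.restrict t))) := by
    rw [tendsto_iff_norm_sub_tendsto_zero]
    have h3 : Tendsto (fun n => (eLpNorm (f n - v) 2 (μ.restrict t)).toReal
        * (eLpNorm (v - u) 2 (μ.restrict t)).toReal) atTop (𝓝 0) := by
      have := ((ENNReal.tendsto_toReal ENNReal.zero_ne_top).comp hlim).mul_const
        (eLpNorm (v - u) 2 (μ.restrict t)).toReal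
      simpa using this
    refine squeeze_zero (fun _ => norm_nonneg _) (fun n => ?_) h3
    have hfn := (hf n).mono_measure hst
    rw [← integral_sub (integrable_mul_of_memLp_two hfn hd) (integrable_mul_of_memLp_two hv hd)]
    refine le_trans (le_of_eq ?_) (abs_integral_mul_le_eLpNorm (hfn.sub hv) hd)
    rw [Real.norm_eq_abs]
    congr 1
    refine integral_congr_ae (.of_forall fun x => ?_)
    simp only [Pi.sub_apply]
    ring
  have h4 := tendsto_nhds_unique h1 h2
  have h5 : ∫ x, (v - u) x ^ 2 ∂(μ.restrict t) = 0 := by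
    rw [← sub_eq_zero.2 h4.symm,
      ← integral_sub (integrable_mul_of_memLp_two hv hd) (integrable_mul_of_memLp_two hut hd)]
    refine integral_congr_ae (.of_forall fun x => ?_)
    simp only [Pi.sub_apply]
    ring
  rw [integral_eq_zero_iff_of_nonneg (fun x => sq_nonneg _) hd.integrable_sq] at h5
  filter_upwards [h5] with x hx
  simpa [sub_eq_zero] using hx

/-- Bounded convergence in `L²` of a finite measure. -/
theorem tendsto_eLpNorm_two_of_bounded [IsFiniteMeasure μ] {f : ℕ → α → ℝ}
    {F : α → ℝ} (hf : ∀ n, AEStronglyMeasurable (f n) μ) {B : ℝ}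
    (hB : ∀ n, ∀ᵐ x ∂μ, |f n x - F x| ≤ B)
    (hlim : ∀ᵐ x ∂μ, Tendsto (fun n => f n x) atTop (𝓝 (F x))) :
    Tendsto (fun n => eLpNorm (f n - F) 2 μ) atTop (𝓝 0) := by
  have hF : AEStronglyMeasurable F μ := aestronglyMeasurable_of_tendsto_ae _ hf hlim
  have h1 : Tendsto (fun n => ∫⁻ x, ENNReal.ofReal ((f n - F) x ^ 2) ∂μ) atTop
      (𝓝 (∫⁻ _, 0 ∂μ)) := by
    refine tendsto_lintegral_of_dominated_convergence' (fun _ => ENNReal.ofReal (B ^ 2))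
      (fun n => (((hf n).sub hF).aemeasurable.pow_const 2).ennreal_ofReal) (fun n => ?_) ?_ ?_
    · filter_upwards [hB n] with x hx
      rw [← sq_abs]
      gcongr
      exact hx
    · rw [lintegral_const]
      exact ENNReal.mul_ne_top ENNReal.ofReal_ne_top (measure_ne_top _ _)
    · filter_upwards [hlim] with x hx
      have h2 : Tendsto (fun n => (f n - F) x ^ 2) atTop (𝓝 0) := by
        have := (hx.sub_const (F x)).pow 2
        simpa using this
      simpa [Function.comp_def] using (ENNReal.continuous_ofReal.tendsto 0).comp h2
  simp only [← eLpNorm_two_sq_eq_lintegral, lintegral_zero] at h1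
  have h2 := ((ENNReal.continuous_rpow_const (y := (1 / 2 : ℝ))).tendsto 0).comp h1
  rw [ENNReal.zero_rpow_of_pos (by norm_num)] at h2
  refine h2.congr fun n => ?_
  simp only [Function.comp_apply]
  rw [← ENNReal.rpow_two, ← ENNReal.rpow_mul]
  norm_num

end SquareIntegrable

/-! ### Riesz representation along a linear map, and a compactness criterion. -/

/-- The Riesz representation theorem for a linear functional `ℓ` that is bounded with respect to
the seminorm pulled back from a Hilbert space along a linear map `ι`. -/
theorem exists_inner_eq_of_abs_le {T H : Type*} [AddCommGroup T] [Module ℝ T]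
    [NormedAddCommGroup H] [InnerProductSpace ℝ H] [CompleteSpace H] (ι : T →ₗ[ℝ] H)
    (ℓ : T →ₗ[ℝ] ℝ) (C : ℝ) (hℓ : ∀ t, |ℓ t| ≤ C * ‖ι t‖) :
    ∃ g : H, ∀ t, ℓ t = inner ℝ g (ι t) := by
  obtain ⟨s, hs⟩ := LinearMap.exists_rightInverse_of_surjective ι.rangeRestrict
    ι.range_rangeRestrict
  have hs' : ∀ y : ι.range, ι (s y) = y := fun y =>
    congrArg Subtype.val (LinearMap.congr_fun hs y)
  -- The bound makes `ℓ` vanish on the kernel of `ι`, so `ℓ` factors through the range whatever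
  -- section `s` was chosen.
  have hfac : ∀ t, ℓ (s (ι.rangeRestrict t)) = ℓ t := by
    intro t
    have h := hℓ (s (ι.rangeRestrict t) - t)
    rw [map_sub, map_sub, hs'] at h
    have h0 : ((ι.rangeRestrict t : ι.range) : H) - ι t = 0 := sub_self _
    rw [h0, norm_zero, mul_zero] at h
    exact sub_eq_zero.1 (abs_nonpos_iff.1 h)
  let f : StrongDual ℝ ι.range := (ℓ ∘ₗ s).mkContinuous C fun y => by
    have h := hℓ (s y)
    rw [hs'] at h
    exact h
  -- The range of `ι` need not be closed, hence Hahn–Banach before Riesz.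
  obtain ⟨F, hF, -⟩ := exists_extension_norm_eq _ f
  refine ⟨(InnerProductSpace.toDual ℝ H).symm F, fun t => ?_⟩
  rw [InnerProductSpace.toDual_symm_apply]
  exact ((hF (ι.rangeRestrict t)).trans (hfac t)).symm

/-- The range of a sequence is relatively compact if all its subsequences have convergent
subsequences. -/
theorem isCompact_closure_range_of_subseq {X : Type*} [PseudoMetricSpace X] {f : ℕ → X}
    (h : ∀ ψ : ℕ → ℕ, Tendsto ψ atTop atTop →
      ∃ φ : ℕ → ℕ, StrictMono φ ∧ ∃ a, Tendsto (fun n => f (ψ (φ n))) atTop (𝓝 a)) :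
    IsCompact (closure (Set.range f)) := by
  -- An index sequence that does not tend to infinity takes some value infinitely often, which gives
  -- a constant subsequence.
  have h' : ∀ ψ : ℕ → ℕ, ∃ φ : ℕ → ℕ, StrictMono φ ∧
      ∃ a, Tendsto (fun n => f (ψ (φ n))) atTop (𝓝 a) := by
    intro ψ
    by_cases hψ : ∀ m, (ψ ⁻¹' {m}).Finite
    · refine h ψ ?_
      rw [← Nat.cofinite_eq_atTop]
      exact Tendsto.cofinite_of_finite_preimage_singleton hψ
    · push Not at hψ
      obtain ⟨m, hm⟩ := hψ
      obtain ⟨φ, hφ, hφm⟩ := extraction_of_frequently_atTop (Nat.frequently_atTop_iff_infinite.2 hm)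
      refine ⟨φ, hφ, f m, tendsto_const_nhds.congr fun n => ?_⟩
      have : ψ (φ n) = m := hφm n
      rw [this]
  rw [isCompact_iff_isSeqCompact]
  intro x hx
  have hx' : ∀ n, ∃ j, dist (x n) (f j) < 1 / ((n : ℝ) + 1) := by
    intro n
    obtain ⟨_, ⟨j, rfl⟩, hj⟩ := Metric.mem_closure_iff.1 (hx n) (1 / ((n : ℝ) + 1)) (by positivity)
    exact ⟨j, hj⟩
  choose ψ hψ using hx'
  obtain ⟨φ, hφ, a, ha⟩ := h' ψ
  have hlim : Tendsto (x ∘ φ) atTop (𝓝 a) := by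
    refine ((tendsto_iff_of_dist ?_).1 ha)
    refine squeeze_zero (fun _ => dist_nonneg) (fun n => ?_)
      (tendsto_one_div_add_atTop_nhds_zero_nat.comp hφ.tendsto_atTop)
    rw [dist_comm]
    exact (hψ (φ n)).le
  exact ⟨a, isClosed_closure.mem_of_tendsto hlim (.of_forall fun n => hx _), φ, hφ, hlim⟩

/-! ### Scaling of Haar measure. -/

section Haar

variable {E : Type*} [NormedAddCommGroup E] [NormedSpace ℝ E] [MeasurableSpace E] [BorelSpace E]
  [FiniteDimensional ℝ E] (μ : Measure E) [μ.IsAddHaarMeasure]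

theorem setLIntegral_closedBall_mul_eq {c : ℝ} (hc : 0 < c) (R : ℝ) {f : E → ℝ≥0∞}
    (hf : Measurable f) :
    ∫⁻ h in Metric.closedBall 0 (c * R), f h ∂μ =
      ENNReal.ofReal (c ^ Module.finrank ℝ E) *
        ∫⁻ ξ in Metric.closedBall 0 R, f (c • ξ) ∂μ := by
  have hpre : (fun x : E => c • x) ⁻¹' Metric.closedBall 0 (c * R) = Metric.closedBall 0 R := by
    ext x
    simp [norm_smul, abs_of_pos hc, hc]
  have hm : Measurable fun x : E => c • x := measurable_const_smul c
  have h1 : ∫⁻ ξ in Metric.closedBall 0 R, f (c • ξ) ∂μ =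
      ∫⁻ h in Metric.closedBall 0 (c * R), f h ∂(Measure.map (fun x => c • x) μ) := by
    rw [setLIntegral_map Metric.isClosed_closedBall.measurableSet hf hm, hpre]
  have hpos : 0 < c ^ Module.finrank ℝ E := by positivity
  rw [h1, Measure.map_addHaar_smul μ hc.ne', Measure.restrict_smul, lintegral_smul_measure,
    smul_eq_mul, ← mul_assoc, ← ENNReal.ofReal_mul hpos.le, abs_of_pos (inv_pos.2 hpos),
    mul_inv_cancel₀ hpos.ne', ENNReal.ofReal_one, one_mul]

end Haar

/-! ### The convolution energy and its slices. -/

section Energy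

variable {d : ℕ} {D : Set (EuclideanSpace ℝ (Fin d))}

theorem isOpen_innerPart (hD : IsOpen D) (t : ℝ) : IsOpen (innerPart D t) :=
  hD.inter (isOpen_lt continuous_const Metric.continuous_infEDist)

/-- A frontier point at distance less than `ρ` would lie in the ball, hence in `D`, but an open set
misses its frontier. -/
theorem mem_innerPart_of_closedBall_subset {x : EuclideanSpace ℝ (Fin d)} {t ρ : ℝ}
    (hD : IsOpen D) (ht : t < ρ) (hρ : 0 < ρ) (h : Metric.closedBall x ρ ⊆ D) :
    x ∈ innerPart D t := by
  refine ⟨h (Metric.mem_closedBall_self hρ.le),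
    ((ENNReal.ofReal_lt_ofReal_iff hρ).2 ht).trans_le (Metric.le_infEDist.2 fun y hy => ?_)⟩
  by_contra! hlt
  have hy' : y ∈ D := by
    refine h ?_
    rw [Metric.mem_closedBall, dist_comm]
    rw [edist_dist, ENNReal.ofReal_lt_ofReal_iff hρ] at hlt
    exact hlt.le
  rw [hD.frontier_eq] at hy
  exact hy.2 hy'

/-- Affine bijections preserve null sets; this makes the inner integral of the energy, for each
fixed `x`, insensitive to the choice of representative. -/
theorem ae_comp_add_smul {p : EuclideanSpace ℝ (Fin d) → Prop} (hp : ∀ᵐ y, p y)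
    (x : EuclideanSpace ℝ (Fin d)) {ε : ℝ} (hε : ε ≠ 0) : ∀ᵐ ξ, p (x + ε • ξ) := by
  have h1 : ∀ᵐ y, p (x + y) :=
    (measurePreserving_add_left volume x).quasiMeasurePreserving.ae hp
  rw [ae_iff] at h1 ⊢
  have h2 := Measure.addHaar_preimage_smul volume hε {a | ¬p (x + a)}
  rw [h1, mul_zero] at h2
  exact h2

/-- Square integrable functions on `D` have strongly measurable representatives that vanish
outside `D`, with the same convolution energies. -/
theorem exists_stronglyMeasurable_representative (hD : IsOpen D)
    {w : EuclideanSpace ℝ (Fin d) → ℝ} (hw : MemLp w 2 (volume.restrict D)) :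
    ∃ W : EuclideanSpace ℝ (Fin d) → ℝ, StronglyMeasurable W ∧ MemLp W 2 volume ∧
      eLpNorm W 2 volume = eLpNorm w 2 (volume.restrict D) ∧
      w =ᵐ[volume.restrict D] W ∧ (∀ x ∉ D, W x = 0) ∧
      ∀ ε σ r : ℝ, ε ≠ 0 → convEnergy D ε σ r W = convEnergy D ε σ r w := by
  set m := hw.1.mk w
  have hm : w =ᵐ[volume.restrict D] m := hw.1.ae_eq_mk
  have hW : w =ᵐ[volume.restrict D] D.indicator m := by
    filter_upwards [hm, ae_restrict_mem hD.measurableSet] with x hx hxD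
    rw [hx, Set.indicator_of_mem hxD]
  refine ⟨D.indicator m, hw.1.stronglyMeasurable_mk.indicator hD.measurableSet,
    (memLp_indicator_iff_restrict hD.measurableSet).2 (hw.ae_eq hm),
    (eLpNorm_indicator_eq_eLpNorm_restrict hD.measurableSet).trans (eLpNorm_congr_ae hm.symm), hW,
    fun x hx => Set.indicator_of_notMem hx _, fun ε σ r hε => ?_⟩
  set W := D.indicator m
  have hW' : ∀ᵐ y, y ∈ D → w y = W y := (ae_restrict_iff' hD.measurableSet).1 hW
  refine lintegral_congr_ae ?_
  filter_upwards [ae_restrict_mem (isOpen_innerPart hD σ).measurableSet,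
    ae_restrict_of_ae hW'] with x hx hxw
  refine lintegral_congr_ae ?_
  have hS : MeasurableSet {ξ : EuclideanSpace ℝ (Fin d) | ‖ξ‖ ≤ r ∧ x + ε • ξ ∈ D} :=
    (measurableSet_le measurable_norm measurable_const).inter
      (hD.preimage (by fun_prop : Continuous fun ξ => x + ε • ξ)).measurableSet
  filter_upwards [ae_restrict_mem hS, ae_restrict_of_ae (ae_comp_add_smul hW' x hε)] with ξ hξ h
  rw [h hξ.2, hxw hx.1]

/-- The contribution of the direction `ξ` to the convolution energy. -/
noncomputable def sliceEnergy (D : Set (EuclideanSpace ℝ (Fin d))) (ε σ : ℝ)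
    (w : EuclideanSpace ℝ (Fin d) → ℝ) (ξ : EuclideanSpace ℝ (Fin d)) : ℝ≥0∞ :=
  ∫⁻ x in {x | x ∈ innerPart D σ ∧ x + ε • ξ ∈ D},
    ENNReal.ofReal (((w (x + ε • ξ) - w x) / ε) ^ 2)

theorem measurableSet_slice (hD : IsOpen D) (ε σ : ℝ) (ξ : EuclideanSpace ℝ (Fin d)) :
    MeasurableSet {x | x ∈ innerPart D σ ∧ x + ε • ξ ∈ D} :=
  ((isOpen_innerPart hD σ).inter
    (hD.preimage (by fun_prop : Continuous fun x => x + ε • ξ))).measurableSet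

theorem measurable_sliceEnergy (hD : IsOpen D) (ε σ : ℝ) {w : EuclideanSpace ℝ (Fin d) → ℝ}
    (hw : StronglyMeasurable w) : Measurable (sliceEnergy D ε σ w) := by
  have hw' := hw.measurable
  have h : Measurable fun p : EuclideanSpace ℝ (Fin d) × EuclideanSpace ℝ (Fin d) =>
      {p : EuclideanSpace ℝ (Fin d) × EuclideanSpace ℝ (Fin d) |
        p.2 ∈ innerPart D σ ∧ p.2 + ε • p.1 ∈ D}.indicator
        (fun p => ENNReal.ofReal (((w (p.2 + ε • p.1) - w p.2) / ε) ^ 2)) p := by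
    refine Measurable.indicator (by fun_prop) ?_
    exact (((isOpen_innerPart hD σ).preimage continuous_snd).inter
      (hD.preimage (by fun_prop : Continuous fun p :
        EuclideanSpace ℝ (Fin d) × EuclideanSpace ℝ (Fin d) => p.2 + ε • p.1))).measurableSet
  convert h.lintegral_prod_right' (ν := volume) using 1
  ext ξ
  rw [sliceEnergy, ← lintegral_indicator (measurableSet_slice hD ε σ ξ)]
  rfl

/-- Tonelli. The condition `x + ε • ξ ∈ D` couples the two variables, so it is moved into an
indicator on the product before the swap. -/
theorem convEnergy_eq_lintegral_sliceEnergy (hD : IsOpen D) (ε σ r : ℝ)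
    {w : EuclideanSpace ℝ (Fin d) → ℝ} (hw : StronglyMeasurable w) :
    convEnergy D ε σ r w = ∫⁻ ξ in Metric.closedBall 0 r, sliceEnergy D ε σ w ξ := by
  have hw' := hw.measurable
  set F : EuclideanSpace ℝ (Fin d) → EuclideanSpace ℝ (Fin d) → ℝ≥0∞ := fun x ξ =>
    {p : EuclideanSpace ℝ (Fin d) × EuclideanSpace ℝ (Fin d) |
      (p.1 ∈ innerPart D σ ∧ p.1 + ε • p.2 ∈ D)}.indicator
      (fun p => ENNReal.ofReal (((w (p.1 + ε • p.2) - w p.1) / ε) ^ 2)) (x, ξ) with hF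
  have hFm : Measurable (Function.uncurry F) := by
    refine Measurable.indicator (by fun_prop) ?_
    exact (((isOpen_innerPart hD σ).preimage continuous_fst).inter
      (hD.preimage (by fun_prop : Continuous fun p :
        EuclideanSpace ℝ (Fin d) × EuclideanSpace ℝ (Fin d) => p.1 + ε • p.2))).measurableSet
  have h1 : convEnergy D ε σ r w =
      ∫⁻ x in innerPart D σ, ∫⁻ ξ in Metric.closedBall 0 r, F x ξ := by
    refine setLIntegral_congr_fun (isOpen_innerPart hD σ).measurableSet fun x hx => ?_
    have hS : MeasurableSet {ξ : EuclideanSpace ℝ (Fin d) | x + ε • ξ ∈ D} :=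
      (hD.preimage (by fun_prop : Continuous fun ξ => x + ε • ξ)).measurableSet
    have hset : {ξ : EuclideanSpace ℝ (Fin d) | ‖ξ‖ ≤ r ∧ x + ε • ξ ∈ D} =
        {ξ | x + ε • ξ ∈ D} ∩ Metric.closedBall 0 r := by
      ext ξ
      simp [and_comm]
    rw [hset, ← Measure.restrict_restrict hS, ← lintegral_indicator hS]
    refine lintegral_congr fun ξ => ?_
    by_cases hξ : x + ε • ξ ∈ D <;> simp [hF, hξ, hx]
  rw [h1, lintegral_lintegral_swap hFm.aemeasurable]
  refine lintegral_congr fun ξ => ?_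
  rw [sliceEnergy, ← lintegral_indicator (measurableSet_slice hD ε σ ξ),
    ← lintegral_indicator (isOpen_innerPart hD σ).measurableSet]
  refine lintegral_congr fun x => ?_
  by_cases hx : x ∈ innerPart D σ <;> by_cases hξ : x + ε • ξ ∈ D <;> simp [hF, hξ, hx]

end Energy

/-! ### Test functions and a criterion for `H¹`. -/

section TestFunctions

variable {d : ℕ}

/-- The difference quotients of a test function converge in `L²` to its directional derivative. -/
theorem tendsto_eLpNorm_differenceQuotient {φ : EuclideanSpace ℝ (Fin d) → ℝ}
    (hφ : ContDiff ℝ ∞ φ) (hc : HasCompactSupport φ) {e : ℕ → ℝ} (he : ∀ n, 0 < e n)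
    (he0 : Tendsto e atTop (𝓝 0)) (ξ : EuclideanSpace ℝ (Fin d)) :
    Tendsto (fun n => eLpNorm ((fun x => (φ (x - e n • ξ) - φ x) / e n) -
      fun x => -fderiv ℝ φ x ξ) 2 volume) atTop (𝓝 0) := by
  obtain ⟨L, hL⟩ := hφ.lipschitzWith_of_hasCompactSupport hc (by simp)
  -- Once `e n * ‖ξ‖ < 1`, all quotients vanish off this fixed compact set, so bounded convergence
  -- applies on a finite measure.
  set K := Metric.cthickening 1 (tsupport φ)
  have hK : IsCompact K := hc.isCompact.cthickening
  have hdiff : Differentiable ℝ φ := hφ.differentiable (by simp)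
  have hcq : ∀ n, Continuous fun x => (φ (x - e n • ξ) - φ x) / e n := fun n =>
    ((hφ.continuous.comp (by fun_prop)).sub hφ.continuous).div_const _
  have hfin : IsFiniteMeasure (volume.restrict K) :=
    ⟨by rw [Measure.restrict_apply_univ]; exact hK.measure_lt_top⟩
  have hmain := tendsto_eLpNorm_two_of_bounded (μ := volume.restrict K)
    (f := fun n x => (φ (x - e n • ξ) - φ x) / e n) (F := fun x => -fderiv ℝ φ x ξ)
    (fun n => (hcq n).aestronglyMeasurable) (B := L * ‖ξ‖ + L * ‖ξ‖)
    (fun n => .of_forall fun x => ?_) (.of_forall fun x => ?_)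
  · refine hmain.congr' ?_
    have hsmall : ∀ᶠ n in atTop, e n * ‖ξ‖ < 1 := by
      have : Tendsto (fun n => e n * ‖ξ‖) atTop (𝓝 0) := by simpa using he0.mul_const ‖ξ‖
      exact this.eventually_lt_const one_pos
    filter_upwards [hsmall] with n hn
    rw [← eLpNorm_indicator_eq_eLpNorm_restrict hK.measurableSet]
    congr 1
    refine Set.indicator_eq_self.2 fun x hx => ?_
    by_contra hxK
    have h1 : x ∉ tsupport φ := fun h => hxK (Metric.self_subset_cthickening _ h)
    have h2 : x - e n • ξ ∉ tsupport φ := by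
      intro h
      refine hxK (Metric.mem_cthickening_of_dist_le x _ 1 _ h ?_)
      rw [dist_eq_norm, sub_sub_cancel, norm_smul, Real.norm_eq_abs, abs_of_pos (he n)]
      exact hn.le
    have h3 : fderiv ℝ φ x = 0 := by
      by_contra h
      exact h1 (support_fderiv_subset ℝ h)
    exact hx (by simp [image_eq_zero_of_notMem_tsupport h1, image_eq_zero_of_notMem_tsupport h2,
      h3])
  · rw [sub_neg_eq_add]
    refine (abs_add_le _ _).trans (add_le_add ?_ ?_)
    · rw [abs_div, abs_of_pos (he n), div_le_iff₀ (he n)]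
      have := hL.dist_le_mul (x - e n • ξ) x
      rw [Real.dist_eq, dist_eq_norm, sub_sub_cancel_left, norm_neg, norm_smul, Real.norm_eq_abs,
        abs_of_pos (he n)] at this
      linarith
    · refine ((fderiv ℝ φ x).le_opNorm ξ).trans ?_
      gcongr
      exact norm_fderiv_le_of_lipschitz ℝ hL
  · have h1 : HasDerivAt (fun t : ℝ => φ (x + t • (-ξ))) (fderiv ℝ φ x (-ξ)) 0 :=
      (hdiff x).hasFDerivAt.hasLineDerivAt (-ξ)
    have h2 := h1.tendsto_slope_zero.comp (tendsto_nhdsWithin_iff.2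
      ⟨he0, .of_forall fun n => (he n).ne'⟩)
    rw [map_neg] at h2
    refine h2.congr fun n => ?_
    simp only [Function.comp_apply, zero_add, zero_smul, smul_neg, smul_eq_mul,
      ← sub_eq_add_neg, sub_zero]
    rw [div_eq_inv_mul]

/-- The smooth functions with compact support in `D`. -/
def testFunctions (D : Set (EuclideanSpace ℝ (Fin d))) :
    Submodule ℝ (EuclideanSpace ℝ (Fin d) → ℝ) where
  carrier := {φ | ContDiff ℝ ∞ φ ∧ HasCompactSupport φ ∧ tsupport φ ⊆ D}
  add_mem' := fun {φ ψ} hφ hψ => ⟨hφ.1.add hψ.1, hφ.2.1.add hψ.2.1,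
    (tsupport_add φ ψ).trans (Set.union_subset hφ.2.2 hψ.2.2)⟩
  zero_mem' := ⟨contDiff_const, HasCompactSupport.zero, by simp [tsupport]⟩
  smul_mem' := fun c φ hφ => ⟨contDiff_const.smul hφ.1, hφ.2.1.smul_left (f := fun _ => c),
    (closure_mono (Function.support_const_smul_subset c φ)).trans hφ.2.2⟩

variable {D : Set (EuclideanSpace ℝ (Fin d))}

theorem memLp_of_mem_testFunctions {φ : EuclideanSpace ℝ (Fin d) → ℝ} (hφ : φ ∈ testFunctions D)
    (S : Set (EuclideanSpace ℝ (Fin d))) : MemLp φ 2 (volume.restrict S) :=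
  (hφ.1.continuous.memLp_of_hasCompactSupport hφ.2.1).restrict S

theorem memLp_fderiv_of_mem_testFunctions {φ : EuclideanSpace ℝ (Fin d) → ℝ}
    (hφ : φ ∈ testFunctions D) (ξ : EuclideanSpace ℝ (Fin d))
    (S : Set (EuclideanSpace ℝ (Fin d))) :
    MemLp (fun x => fderiv ℝ φ x ξ) 2 (volume.restrict S) :=
  (((hφ.1.continuous_fderiv (by simp)).clm_apply continuous_const).memLp_of_hasCompactSupport
    (hφ.2.1.fderiv_apply ℝ ξ)).restrict S

/-- The directions `ξ` for which the distributional derivative of `u` in direction `ξ` is bounded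
with respect to the `L²` norm. -/
def boundedDirections {u : EuclideanSpace ℝ (Fin d) → ℝ} (hu : MemLp u 2 (volume.restrict D)) :
    Submodule ℝ (EuclideanSpace ℝ (Fin d)) where
  carrier := {ξ | ∃ c : ℝ, ∀ φ ∈ testFunctions D,
    |∫ x in D, u x * fderiv ℝ φ x ξ| ≤ c * (eLpNorm φ 2 (volume.restrict D)).toReal}
  add_mem' := by
    rintro ξ η ⟨c, hc⟩ ⟨c', hc'⟩
    refine ⟨c + c', fun φ hφ => ?_⟩
    simp only [map_add, mul_add]
    rw [integral_add
      (integrable_mul_of_memLp_two hu (memLp_fderiv_of_mem_testFunctions hφ ξ D))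
      (integrable_mul_of_memLp_two hu (memLp_fderiv_of_mem_testFunctions hφ η D)), add_mul]
    exact (abs_add_le _ _).trans (add_le_add (hc φ hφ) (hc' φ hφ))
  zero_mem' := ⟨0, fun φ _ => by simp⟩
  smul_mem' := by
    rintro a ξ ⟨c, hc⟩
    refine ⟨|a| * c, fun φ hφ => ?_⟩
    have h : ∀ x, u x * fderiv ℝ φ x (a • ξ) = a * (u x * fderiv ℝ φ x ξ) := fun x => by
      rw [map_smul, smul_eq_mul]; ring
    simp only [h]
    rw [integral_const_mul, abs_mul, mul_assoc]
    gcongr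
    exact hc φ hφ

/-- A function whose distributional derivatives in all directions are bounded with respect to the
`L²` norm belongs to `H¹`. -/
theorem memH1_of_boundedDirections_eq_top {u : EuclideanSpace ℝ (Fin d) → ℝ}
    (hu : MemLp u 2 (volume.restrict D)) (h : boundedDirections hu = ⊤) : MemH1 D u := by
  refine ⟨hu, fun i => ?_⟩
  set ξ : EuclideanSpace ℝ (Fin d) := EuclideanSpace.single i 1
  obtain ⟨c, hc⟩ : ξ ∈ boundedDirections hu := h ▸ Submodule.mem_top
  let ι : testFunctions D →ₗ[ℝ] Lp ℝ 2 (volume.restrict D) :=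
    { toFun := fun φ => (memLp_of_mem_testFunctions φ.2 D).toLp φ.1
      map_add' := fun φ ψ => rfl
      map_smul' := fun a φ => rfl }
  let ℓ : testFunctions D →ₗ[ℝ] ℝ :=
    { toFun := fun φ => ∫ x in D, u x * fderiv ℝ φ.1 x ξ
      map_add' := fun φ ψ => by
        rw [← integral_add
          (integrable_mul_of_memLp_two hu (memLp_fderiv_of_mem_testFunctions φ.2 ξ D))
          (integrable_mul_of_memLp_two hu (memLp_fderiv_of_mem_testFunctions ψ.2 ξ D))]
        refine integral_congr_ae (.of_forall fun x => ?_)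
        have h1 : fderiv ℝ (φ.1 + ψ.1) x = fderiv ℝ φ.1 x + fderiv ℝ ψ.1 x :=
          fderiv_add (φ.2.1.differentiable (by simp) x) (ψ.2.1.differentiable (by simp) x)
        simp only [Submodule.coe_add, h1, add_apply, mul_add]
      map_smul' := fun a φ => by
        rw [RingHom.id_apply, smul_eq_mul, ← integral_const_mul]
        refine integral_congr_ae (.of_forall fun x => ?_)
        have h1 : fderiv ℝ (a • φ.1) x = a • fderiv ℝ φ.1 x :=
          fderiv_const_smul (φ.2.1.differentiable (by simp) x) a
        simp only [Submodule.coe_smul, h1, smul_apply, smul_eq_mul]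
        ring }
  obtain ⟨g, hg⟩ := exists_inner_eq_of_abs_le ι ℓ c fun φ => by
    have h1 : ‖ι φ‖ = (eLpNorm φ.1 2 (volume.restrict D)).toReal := 
      Lp.norm_toLp _ (memLp_of_mem_testFunctions φ.2 D)
    rw [h1]
    exact hc φ.1 φ.2
  -- The Riesz vector represents `∫ u ∂_ξ φ`; the weak derivative carries the opposite sign.
  refine ⟨fun x => -g x, (Lp.memLp g).neg, fun φ h1 h2 h3 => ?_⟩
  have hφ : φ ∈ testFunctions D := ⟨h1, h2, h3⟩
  have h4 := hg ⟨φ, hφ⟩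
  have h5 := inner_toLp_eq_integral (Lp.memLp g) (memLp_of_mem_testFunctions hφ D)
  rw [Lp.toLp_coeFn] at h5
  simp only [neg_mul, integral_neg, neg_neg]
  exact h4.trans h5

end TestFunctions

/-! ### Regularity of weak limits. -/

section WeakLimit

variable {d : ℕ} {D : Set (EuclideanSpace ℝ (Fin d))}

theorem eLpNorm_two_le_of_lintegral_sq_le {α : Type*} [MeasurableSpace α] {μ : Measure α}
    {f : α → ℝ} {c : ℝ≥0∞} (h : ∫⁻ x, ENNReal.ofReal (f x ^ 2) ∂μ ≤ c ^ 2) :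
    eLpNorm f 2 μ ≤ c := by
  rw [← eLpNorm_two_sq_eq_lintegral] at h
  by_contra! hlt
  exact absurd h (not_le.2 (ENNReal.pow_lt_pow_left two_ne_zero hlt))

theorem memLp_comp_add {w : EuclideanSpace ℝ (Fin d) → ℝ} (hw : MemLp w 2 volume)
    (a : EuclideanSpace ℝ (Fin d)) : MemLp (fun x => w (x + a)) 2 volume :=
  hw.comp_measurePreserving (measurePreserving_add_right volume a)

/-- Discrete integration by parts: the difference quotients of `w` are controlled by the slice
energy. -/
theorem abs_integral_mul_differenceQuotient_le
    {w : EuclideanSpace ℝ (Fin d) → ℝ} (hw : MemLp w 2 volume) (hw0 : ∀ x ∉ D, w x = 0)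
    {φ : EuclideanSpace ℝ (Fin d) → ℝ} (hφ : φ ∈ testFunctions D) {ε σ : ℝ}
    {ξ : EuclideanSpace ℝ (Fin d)}
    (hsupp : ∀ x ∈ tsupport φ, x ∈ innerPart D σ ∧ x + ε • ξ ∈ D) {c : ℝ≥0}
    (hc : sliceEnergy D ε σ w ξ ≤ (c : ℝ≥0∞) ^ 2) :
    |∫ x in D, w x * ((φ (x - ε • ξ) - φ x) / ε)| ≤
      c * (eLpNorm φ 2 (volume.restrict D)).toReal := by
  set S := {x | x ∈ innerPart D σ ∧ x + ε • ξ ∈ D}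
  set q : EuclideanSpace ℝ (Fin d) → ℝ := fun x => (w (x + ε • ξ) - w x) / ε with hq
  have hφ2 : MemLp φ 2 volume := by simpa using memLp_of_mem_testFunctions hφ Set.univ
  have hws := memLp_comp_add hw (ε • ξ)
  have hφs : MemLp (fun x => φ (x - ε • ξ)) 2 volume := by
    simpa [sub_eq_add_neg] using memLp_comp_add hφ2 (-(ε • ξ))
  have hqL : MemLp q 2 volume := by
    have := (hws.sub hw).const_mul ε⁻¹
    refine this.ae_eq (.of_forall fun x => ?_)
    simp [hq, div_eq_inv_mul]
  have h1 : ∫ x in D, w x * ((φ (x - ε • ξ) - φ x) / ε) = ∫ x in S, q x * φ x := by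
    -- Both integrals extend to the whole space, since `w` vanishes off `D` and `φ` off `S`; there
    -- translation invariance moves the difference from `φ` to `w`.
    rw [setIntegral_eq_integral_of_forall_compl_eq_zero fun x hx => by rw [hw0 x hx, zero_mul],
      setIntegral_eq_integral_of_forall_compl_eq_zero (s := S) fun x hx => by
        rw [image_eq_zero_of_notMem_tsupport fun h => hx (hsupp x h), mul_zero]]
    have h2 : ∫ x, w x * φ (x - ε • ξ) = ∫ x, w (x + ε • ξ) * φ x := by
      rw [← integral_add_right_eq_self (fun x => w x * φ (x - ε • ξ)) (ε • ξ)]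
      simp only [add_sub_cancel_right]
    calc ∫ x, w x * ((φ (x - ε • ξ) - φ x) / ε)
        = ∫ x, ε⁻¹ * (w x * φ (x - ε • ξ) - w x * φ x) := by
          refine integral_congr_ae (.of_forall fun x => ?_)
          simp only
          ring
      _ = ∫ x, ε⁻¹ * (w (x + ε • ξ) * φ x - w x * φ x) := by
          rw [integral_const_mul, integral_const_mul,
            integral_sub (integrable_mul_of_memLp_two hw hφs) (integrable_mul_of_memLp_two hw hφ2),
            integral_sub (integrable_mul_of_memLp_two hws hφ2) (integrable_mul_of_memLp_two hw hφ2),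
            h2]
      _ = ∫ x, q x * φ x := by
          refine integral_congr_ae (.of_forall fun x => ?_)
          simp only [hq]
          ring
  rw [h1]
  refine (abs_integral_mul_le_eLpNorm (hqL.restrict S) (hφ2.restrict S)).trans ?_
  gcongr
  · exact ENNReal.toReal_le_coe_of_le_coe (eLpNorm_two_le_of_lintegral_sq_le hc)
  · exact (hφ2.restrict D).eLpNorm_ne_top
  · exact fun x hx => hx.1.1

/-- Half of a thickening radius is spent on the shift `a`, half on the ball, so that shifted points
still keep a definite distance from the boundary. -/
theorem exists_pos_forall_closedBall_subset (hD : IsOpen D) {K : Set (EuclideanSpace ℝ (Fin d))}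
    (hK : IsCompact K) (hKD : K ⊆ D) :
    ∃ ρ : ℝ, 0 < ρ ∧ ∀ x ∈ K, ∀ a, ‖a‖ ≤ ρ → Metric.closedBall (x + a) ρ ⊆ D := by
  obtain ⟨ρ, hρ, h⟩ := hK.exists_cthickening_subset_open hD hKD
  refine ⟨ρ / 2, half_pos hρ, fun x hx a ha y hy => h ?_⟩
  refine Metric.mem_cthickening_of_dist_le y x ρ K hx ?_
  have h1 : dist (x + a) x = ‖a‖ := by rw [dist_eq_norm, add_sub_cancel_left]
  have h2 := dist_triangle y (x + a) x
  rw [Metric.mem_closedBall] at hy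
  linarith

/-- Weak `L²` limits of sequences with bounded convolution energies are in `H¹`. -/
theorem memH1_of_tendstoWeakL2 (hD : IsOpen D) {w : ℕ → EuclideanSpace ℝ (Fin d) → ℝ}
    (hwm : ∀ n, StronglyMeasurable (w n)) (hw : ∀ n, MemLp (w n) 2 volume)
    (hw0 : ∀ n, ∀ x ∉ D, w n x = 0) {M : ℝ≥0}
    (hM : ∀ n, eLpNorm (w n) 2 (volume.restrict D) ≤ M) {e : ℕ → ℝ} (he : ∀ n, 0 < e n)
    (he0 : Tendsto e atTop (𝓝 0)) {k r : ℝ} (hr : 0 < r) {C : ℝ≥0}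
    (hC : ∀ n, convEnergy D (e n) (k * e n) r (w n) ≤ C) {u : EuclideanSpace ℝ (Fin d) → ℝ}
    (hu : MemLp u 2 (volume.restrict D)) (hweak : TendstoWeakL2 (volume.restrict D) w u) :
    MemH1 D u := by
  refine memH1_of_boundedDirections_eq_top hu ?_
  set G : ℕ → EuclideanSpace ℝ (Fin d) → ℝ≥0∞ := fun n => sliceEnergy D (e n) (k * e n) (w n)
  have hGm : ∀ n, Measurable (G n) := fun n => measurable_sliceEnergy hD _ _ (hwm n)
  have hfatou : ∫⁻ ξ in Metric.closedBall 0 r, liminf (fun n => G n ξ) atTop ≤ C := by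
    refine (lintegral_liminf_le hGm).trans ?_
    refine liminf_le_of_le (by isBoundedDefault) fun b hb => ?_
    obtain ⟨n, hn⟩ := hb.exists
    refine hn.trans ?_
    rw [← convEnergy_eq_lintegral_sliceEnergy hD _ _ _ (hwm n)]
    exact hC n
  have hae : ∀ᵐ ξ ∂(volume.restrict (Metric.closedBall 0 r)),
      ξ ∈ boundedDirections hu := by
    filter_upwards [ae_lt_top (Measurable.liminf hGm)
      (hfatou.trans_lt ENNReal.coe_lt_top).ne] with ξ hξ
    -- The slice energy is below `b` for infinitely many `n`, depending on `ξ`. That suffices: the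
    -- integrals converge along the full sequence, and `b` does not depend on `φ`.
    obtain ⟨b, hb1, hb2⟩ := exists_between hξ
    have hfreq : ∃ᶠ n in atTop, G n ξ < b :=
      frequently_lt_of_liminf_lt (by isBoundedDefault) hb1
    refine ⟨NNReal.sqrt b.toNNReal, fun φ hφ => ?_⟩
    obtain ⟨ρ, hρ, hball⟩ := exists_pos_forall_closedBall_subset hD hφ.2.1.isCompact hφ.2.2
    have hlim : Tendsto (fun n => ∫ x in D, w n x * ((φ (x - e n • ξ) - φ x) / e n)) atTop
        (𝓝 (∫ x in D, u x * -fderiv ℝ φ x ξ)) := by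
      refine hweak.tendsto_integral_mul (fun n => (hw n).restrict D) hM (fun n => ?_)
        (memLp_fderiv_of_mem_testFunctions hφ ξ D).neg
        (tendsto_of_tendsto_of_tendsto_of_le_of_le tendsto_const_nhds
          (tendsto_eLpNorm_differenceQuotient hφ.1 hφ.2.1 he he0 ξ) (fun _ => zero_le)
          fun n => eLpNorm_mono_measure _ Measure.restrict_le_self)
      have hφ2 : MemLp φ 2 volume := by simpa using memLp_of_mem_testFunctions hφ Set.univ
      have hφs : MemLp (fun x => φ (x - e n • ξ)) 2 volume := by
        simpa [sub_eq_add_neg] using memLp_comp_add hφ2 (-(e n • ξ))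
      refine (((hφs.sub hφ2).const_mul (e n)⁻¹).restrict D).ae_eq (.of_forall fun x => ?_)
      simp [div_eq_inv_mul]
    have habs : |∫ x in D, u x * fderiv ℝ φ x ξ| = |∫ x in D, u x * -fderiv ℝ φ x ξ| := by
      simp only [mul_neg, integral_neg, abs_neg]
    rw [habs]
    refine isClosed_Iic.mem_of_frequently_of_tendsto ?_ hlim.abs
    have h1 : ∀ᶠ n in atTop, k * e n < ρ := by
      have : Tendsto (fun n => k * e n) atTop (𝓝 0) := by simpa using he0.const_mul k
      exact this.eventually_lt_const hρ
    have h2 : ∀ᶠ n in atTop, e n * ‖ξ‖ < ρ := by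
      have : Tendsto (fun n => e n * ‖ξ‖) atTop (𝓝 0) := by simpa using he0.mul_const ‖ξ‖
      exact this.eventually_lt_const hρ
    refine (hfreq.and_eventually (h1.and h2)).mono fun n hn => ?_
    refine abs_integral_mul_differenceQuotient_le (σ := k * e n) (hw n) (hw0 n) hφ
      (fun x hx => ⟨?_, ?_⟩) ?_
    · refine mem_innerPart_of_closedBall_subset hD hn.2.1 hρ ?_
      simpa using hball x hx 0 (by simpa using hρ.le)
    · refine hball x hx (e n • ξ) ?_ (Metric.mem_closedBall_self hρ.le)
      rw [norm_smul, Real.norm_eq_abs, abs_of_pos (he n)]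
      exact hn.2.2.le
    · rw [← ENNReal.coe_pow, NNReal.sq_sqrt, ENNReal.coe_toNNReal hb2.ne]
      exact hn.1.le
  -- A proper subspace is null, yet this one contains almost all of a ball of positive measure.
  by_contra hne
  have hzero := Measure.addHaar_submodule volume _ hne
  have hball : volume (Metric.closedBall (0 : EuclideanSpace ℝ (Fin d)) r) = 0 := by
    refine measure_mono_null (fun ξ hξ => ?_)
      (measure_union_null hzero (ae_iff.1 ((ae_restrict_iff'
        Metric.isClosed_closedBall.measurableSet).1 hae)))
    by_cases h : ξ ∈ boundedDirections hu
    · exact Or.inl h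
    · exact Or.inr fun h' => h (h' hξ)
  exact (Metric.measure_closedBall_pos volume _ hr).ne' hball

end WeakLimit

/-! ### Translation estimates and strong local convergence. -/

section Compactness

variable {d : ℕ} {D : Set (EuclideanSpace ℝ (Fin d))}

theorem eLpNorm_comp_add_le {f : EuclideanSpace ℝ (Fin d) → ℝ}
    (hf : AEStronglyMeasurable f volume) {S T : Set (EuclideanSpace ℝ (Fin d))}
    (hS : MeasurableSet S) {a : EuclideanSpace ℝ (Fin d)} (h : ∀ x ∈ T, x + a ∈ S) :
    eLpNorm (fun x => f (x + a)) 2 (volume.restrict T) ≤ eLpNorm f 2 (volume.restrict S) := by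
  have hmp := (measurePreserving_add_right volume a).restrict_preimage hS
  have h1 := eLpNorm_comp_measurePreserving (p := 2) hf.restrict hmp
  rw [← h1]
  exact eLpNorm_mono_measure _ (Measure.restrict_mono h le_rfl)

/-- A translation by `N • h` is controlled by `N` translations by `h`. -/
theorem eLpNorm_shift_nsmul_le {w : EuclideanSpace ℝ (Fin d) → ℝ} (hw : MemLp w 2 volume)
    {S T : Set (EuclideanSpace ℝ (Fin d))} (hS : MeasurableSet S) {h : EuclideanSpace ℝ (Fin d)}
    (N : ℕ) (hST : ∀ x ∈ T, ∀ m < N, x + (m : ℝ) • h ∈ S) :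
    eLpNorm (fun x => w (x + (N : ℝ) • h) - w x) 2 (volume.restrict T) ≤
      N * eLpNorm (fun x => w (x + h) - w x) 2 (volume.restrict S) := by
  induction N with
  | zero => simp
  | succ N ih =>
    have h1 := ih fun x hx m hm => hST x hx m (by omega)
    have hd : AEStronglyMeasurable (fun x => w (x + h) - w x) volume :=
      (memLp_comp_add hw h).1.sub hw.1
    have h2 := eLpNorm_comp_add_le hd hS (T := T) (a := (N : ℝ) • h)
      fun x hx => hST x hx N (by omega)
    have h3 : (fun x => w (x + ((N + 1 : ℕ) : ℝ) • h) - w x) =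
        (fun x => w (x + (N : ℝ) • h + h) - w (x + (N : ℝ) • h)) +
          fun x => w (x + (N : ℝ) • h) - w x := by
      ext x
      simp [add_smul, add_assoc]
    have hN := memLp_comp_add hw ((N : ℝ) • h)
    have hN1 : AEStronglyMeasurable (fun x => w (x + (N : ℝ) • h + h)) volume := by
      simpa only [add_assoc] using (memLp_comp_add hw ((N : ℝ) • h + h)).1
    rw [h3]
    refine (eLpNorm_add_le (hN1.sub hN.1).restrict (hN.1.sub hw.1).restrict (by norm_num)).trans ?_
    rw [Nat.cast_add, Nat.cast_one, add_mul, one_mul, add_comm]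
    exact add_le_add h1 h2

/-- The chain of `N` steps `ε • ξ` stays within `ρ` of its starting point, so each step starts and
ends where the slice energy sees it. Each step costs at most `ε` times the root of that energy. -/
theorem lintegral_sq_shift_le_sliceEnergy (hD : IsOpen D) {w : EuclideanSpace ℝ (Fin d) → ℝ}
    (hw : MemLp w 2 volume) {T : Set (EuclideanSpace ℝ (Fin d))} {ρ : ℝ} (hρ : 0 < ρ)
    (hT : ∀ x ∈ T, ∀ a, ‖a‖ ≤ ρ → Metric.closedBall (x + a) ρ ⊆ D) {ε σ : ℝ} (hε : 0 < ε)
    (hσ : σ < ρ) (N : ℕ) {ξ : EuclideanSpace ℝ (Fin d)} (hξ : ‖(N * ε) • ξ‖ ≤ ρ) :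
    ∫⁻ x in T, ENNReal.ofReal ((w (x + (N * ε) • ξ) - w x) ^ 2) ≤
      ENNReal.ofReal ((N * ε) ^ 2) * sliceEnergy D ε σ w ξ := by
  have hm : ∀ m ≤ N, ‖(m : ℝ) • ε • ξ‖ ≤ ρ := by
    intro m hm
    refine le_trans ?_ hξ
    rw [smul_smul, norm_smul, norm_smul, Real.norm_eq_abs, Real.norm_eq_abs,
      abs_of_nonneg (by positivity), abs_of_nonneg (by positivity)]
    gcongr
  have h1 := eLpNorm_shift_nsmul_le hw (measurableSet_slice hD ε σ ξ) (T := T) (h := ε • ξ) N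
    fun x hx m hmN => by
      refine ⟨mem_innerPart_of_closedBall_subset hD hσ hρ (hT x hx _ (hm m hmN.le)), ?_⟩
      -- The endpoint of the step must also lie in `D`, hence the index `m + 1 ≤ N`.
      have := hT x hx _ (hm (m + 1) hmN) (Metric.mem_closedBall_self hρ.le)
      simpa [add_smul, add_assoc] using this
  have h2 := pow_le_pow_left' h1 2
  rw [mul_pow, eLpNorm_two_sq_eq_lintegral, eLpNorm_two_sq_eq_lintegral] at h2
  simp only [smul_smul] at h2
  refine h2.trans (le_of_eq ?_)
  rw [mul_pow, ENNReal.ofReal_mul (by positivity), mul_assoc,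
    ENNReal.ofReal_pow (Nat.cast_nonneg N), ENNReal.ofReal_natCast, sliceEnergy, ← lintegral_const_mul' _ _ ENNReal.ofReal_ne_top]
  congr 1
  refine lintegral_congr fun x => ?_
  rw [← ENNReal.ofReal_mul (by positivity), div_pow, mul_div_cancel₀ _ (by positivity)]

/-- All small translations are controlled in mean square by the convolution energy. -/
theorem lintegral_lintegral_sq_shift_le (hD : IsOpen D) {w : EuclideanSpace ℝ (Fin d) → ℝ}
    (hwm : StronglyMeasurable w) (hw : MemLp w 2 volume) {T : Set (EuclideanSpace ℝ (Fin d))}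
    {ρ : ℝ} (hρ : 0 < ρ) (hT : ∀ x ∈ T, ∀ a, ‖a‖ ≤ ρ → Metric.closedBall (x + a) ρ ⊆ D)
    {ε σ r δ : ℝ} (hε : 0 < ε) (hσ : σ < ρ) (hr : 0 < r) (hεδ : ε ≤ δ) (hδ : δ * r ≤ ρ) :
    ∫⁻ h in Metric.closedBall 0 (δ * r), ∫⁻ x in T, ENNReal.ofReal ((w (x + h) - w x) ^ 2) ≤
      ENNReal.ofReal ((2 * δ) ^ (d + 2)) * convEnergy D ε σ r w := by
  have hw' := hwm.measurable
  have hδ0 : 0 < δ := hε.trans_le hεδ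
  -- This gives `δ ≤ N * ε ≤ 2 * δ`: the lower bound keeps the rescaled directions in the ball of
  -- radius `r`, the upper bound controls the constant.
  set N := ⌈δ / ε⌉₊
  set c : ℝ := N * ε with hc
  have hδc : δ ≤ c := (div_le_iff₀ hε).1 (Nat.le_ceil _)
  have hc0 : 0 < c := hδ0.trans_le hδc
  have hc2 : c ≤ 2 * δ := by
    have h1 : (N : ℝ) < δ / ε + 1 := Nat.ceil_lt_add_one (by positivity)
    have h2 : c ≤ (δ / ε + 1) * ε := by rw [hc]; gcongr
    have h3 : (δ / ε + 1) * ε = δ + ε := by field_simp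
    linarith
  have hmeas : Measurable fun h : EuclideanSpace ℝ (Fin d) =>
      ∫⁻ x in T, ENNReal.ofReal ((w (x + h) - w x) ^ 2) := by
    refine Measurable.lintegral_prod_right' (ν := volume.restrict T)
      (f := fun p : EuclideanSpace ℝ (Fin d) × EuclideanSpace ℝ (Fin d) =>
        ENNReal.ofReal ((w (p.2 + p.1) - w p.2) ^ 2)) ?_
    fun_prop
  have hR : δ * r = c * (δ * r / c) := by field_simp
  rw [hR, setLIntegral_closedBall_mul_eq volume hc0 _ hmeas, finrank_euclideanSpace_fin,
    convEnergy_eq_lintegral_sliceEnergy hD _ _ _ hwm]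
  have hrad : δ * r / c ≤ r := by
    rw [div_le_iff₀ hc0, mul_comm r]
    gcongr
  calc ENNReal.ofReal (c ^ d) * ∫⁻ ξ in Metric.closedBall 0 (δ * r / c),
        ∫⁻ x in T, ENNReal.ofReal ((w (x + c • ξ) - w x) ^ 2)
      ≤ ENNReal.ofReal (c ^ d) * ∫⁻ ξ in Metric.closedBall 0 (δ * r / c),
          ENNReal.ofReal (c ^ 2) * sliceEnergy D ε σ w ξ := by
        gcongr ENNReal.ofReal (c ^ d) * ?_
        refine setLIntegral_mono' Metric.isClosed_closedBall.measurableSet fun ξ hξ => ?_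
        refine lintegral_sq_shift_le_sliceEnergy hD hw hρ hT hε hσ N ?_
        rw [← hc, norm_smul, Real.norm_eq_abs, abs_of_pos hc0]
        rw [mem_closedBall_zero_iff, le_div_iff₀ hc0] at hξ
        linarith
    _ ≤ ENNReal.ofReal (c ^ d) * ∫⁻ ξ in Metric.closedBall 0 r,
          ENNReal.ofReal (c ^ 2) * sliceEnergy D ε σ w ξ := by
        gcongr ENNReal.ofReal (c ^ d) * ?_
        exact lintegral_mono_set (Metric.closedBall_subset_closedBall hrad)
    -- The power `d` is the Jacobian of `h = c • ξ`; the extra `2` comes from the squared shift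
    -- length.
    _ = ENNReal.ofReal (c ^ (d + 2)) * ∫⁻ ξ in Metric.closedBall 0 r, sliceEnergy D ε σ w ξ := by
        rw [lintegral_const_mul' _ _ ENNReal.ofReal_ne_top, ← mul_assoc,
          ← ENNReal.ofReal_mul (by positivity), pow_add]
    _ ≤ _ := by gcongr

theorem ofReal_integral_sq_le {α : Type*} [MeasurableSpace α] {ν : Measure α} [IsFiniteMeasure ν]
    {f : α → ℝ} (hf : MemLp f 2 ν) :
    ENNReal.ofReal ((∫ x, f x ∂ν) ^ 2) ≤ (∫⁻ x, ENNReal.ofReal (f x ^ 2) ∂ν) * ν Set.univ := by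
  have h1 : MemLp (fun _ : α => (1 : ℝ)) 2 ν := memLp_const 1
  have h2 := abs_integral_mul_le_eLpNorm hf h1
  simp only [mul_one] at h2
  have h3 : ν Set.univ = eLpNorm (fun _ : α => (1 : ℝ)) 2 ν ^ 2 := by
    rw [eLpNorm_two_sq_eq_lintegral]
    simp
  rw [h3, ← eLpNorm_two_sq_eq_lintegral, ← mul_pow, ← sq_abs,
    ENNReal.ofReal_pow (abs_nonneg _)]
  gcongr
  refine (ENNReal.ofReal_le_ofReal h2).trans ?_
  rw [ENNReal.ofReal_mul ENNReal.toReal_nonneg, ENNReal.ofReal_toReal hf.eLpNorm_ne_top,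
    ENNReal.ofReal_toReal h1.eLpNorm_ne_top]

/-- The average of `w` over the closed ball of radius `R` around `x`. -/
noncomputable def ballAverage (R : ℝ) (w : EuclideanSpace ℝ (Fin d) → ℝ)
    (x : EuclideanSpace ℝ (Fin d)) : ℝ :=
  ⨍ h in Metric.closedBall 0 R, w (x + h)

theorem stronglyMeasurable_ballAverage (R : ℝ) {w : EuclideanSpace ℝ (Fin d) → ℝ}
    (hwm : StronglyMeasurable w) : StronglyMeasurable (ballAverage R w) := by
  have h : StronglyMeasurable
      fun p : EuclideanSpace ℝ (Fin d) × EuclideanSpace ℝ (Fin d) => w (p.1 + p.2) :=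
    hwm.comp_measurable (by fun_prop)
  have h2 : ballAverage R w = fun x =>
      (volume.real (Metric.closedBall (0 : EuclideanSpace ℝ (Fin d)) R))⁻¹ •
        ∫ h in Metric.closedBall 0 R, w (x + h) := by
    ext x
    rw [ballAverage, setAverage_eq]
  rw [h2]
  exact (h.integral_prod_right' (ν := volume.restrict (Metric.closedBall 0 R))).const_smul
    (volume.real (Metric.closedBall (0 : EuclideanSpace ℝ (Fin d)) R))⁻¹

theorem memLp_add_left {w : EuclideanSpace ℝ (Fin d) → ℝ} (hw : MemLp w 2 volume)
    (x : EuclideanSpace ℝ (Fin d)) : MemLp (fun h => w (x + h)) 2 volume :=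
  hw.comp_measurePreserving (measurePreserving_add_left volume x)

/-- Up to sign, the left difference is the mean of `w (x + h) - w x`; Cauchy–Schwarz against `1`
yields two volume factors on the left and one on the right, and one cancels. -/
theorem sub_ballAverage_sq_mul_le {R : ℝ} (hR : 0 < R) {w : EuclideanSpace ℝ (Fin d) → ℝ}
    (hw : MemLp w 2 volume) (x : EuclideanSpace ℝ (Fin d)) :
    ENNReal.ofReal ((w x - ballAverage R w x) ^ 2) *
        volume (Metric.closedBall (0 : EuclideanSpace ℝ (Fin d)) R) ≤
      ∫⁻ h in Metric.closedBall 0 R, ENNReal.ofReal ((w (x + h) - w x) ^ 2) := by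
  set B := Metric.closedBall (0 : EuclideanSpace ℝ (Fin d)) R
  have hB0 : volume B ≠ 0 := (Metric.measure_closedBall_pos volume _ hR).ne'
  have hBt : volume B ≠ ⊤ := measure_closedBall_lt_top.ne
  have hfin : IsFiniteMeasure (volume.restrict B) :=
    ⟨by rw [Measure.restrict_apply_univ]; exact hBt.lt_top⟩
  have hx := (memLp_add_left hw x).restrict B
  have hf : MemLp (fun h => w (x + h) - w x) 2 (volume.restrict B) := hx.sub (memLp_const _)
  have h1 := ofReal_integral_sq_le hf
  have hpos : 0 < volume.real B := ENNReal.toReal_pos hB0 hBt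
  have h2 : ∫ h in B, (w (x + h) - w x) = volume.real B * (ballAverage R w x - w x) := by
    rw [integral_sub (hx.integrable (by norm_num)) (integrable_const _), setIntegral_const,
      ballAverage, setAverage_eq, mul_sub, smul_eq_mul, smul_eq_mul, mul_inv_cancel_left₀ hpos.ne']
  rw [h2, Measure.restrict_apply_univ, mul_pow, ENNReal.ofReal_mul (by positivity),
    ENNReal.ofReal_pow hpos.le, Measure.real, ENNReal.ofReal_toReal hBt] at h1
  have h3 : (ballAverage R w x - w x) ^ 2 = (w x - ballAverage R w x) ^ 2 := by ring
  rw [h3] at h1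
  refine (ENNReal.mul_le_mul_iff_left hB0 hBt).1 (le_trans (le_of_eq ?_) h1)
  ring

/-- The averages over small balls approximate `w` uniformly with respect to the energy. -/
theorem eLpNorm_sub_ballAverage_sq_le (hD : IsOpen D) {w : EuclideanSpace ℝ (Fin d) → ℝ}
    (hwm : StronglyMeasurable w) (hw : MemLp w 2 volume) {T : Set (EuclideanSpace ℝ (Fin d))}
    {ρ : ℝ} (hρ : 0 < ρ) (hT : ∀ x ∈ T, ∀ a, ‖a‖ ≤ ρ → Metric.closedBall (x + a) ρ ⊆ D)
    {ε σ r δ : ℝ} (hε : 0 < ε) (hσ : σ < ρ) (hr : 0 < r) (hεδ : ε ≤ δ) (hδ : δ * r ≤ ρ) :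
    eLpNorm (w - ballAverage (δ * r) w) 2 (volume.restrict T) ^ 2 ≤
      ENNReal.ofReal (δ ^ 2) * (ENNReal.ofReal (2 ^ (d + 2)) * convEnergy D ε σ r w /
        volume (Metric.closedBall (0 : EuclideanSpace ℝ (Fin d)) r)) := by
  have hw' := hwm.measurable
  have hδ0 : 0 < δ := hε.trans_le hεδ
  have hB0 := (Metric.measure_closedBall_pos volume (0 : EuclideanSpace ℝ (Fin d)) hr).ne'
  have hBt := (measure_closedBall_lt_top (μ := volume)
    (x := (0 : EuclideanSpace ℝ (Fin d))) (r := r)).ne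
  have hvol : volume (Metric.closedBall (0 : EuclideanSpace ℝ (Fin d)) (δ * r)) =
      ENNReal.ofReal (δ ^ d) * volume (Metric.closedBall (0 : EuclideanSpace ℝ (Fin d)) r) := by
    have := setLIntegral_closedBall_mul_eq (volume : Measure (EuclideanSpace ℝ (Fin d))) hδ0 r
      (f := fun _ => 1) measurable_const
    simpa using this
  have h1 : eLpNorm (w - ballAverage (δ * r) w) 2 (volume.restrict T) ^ 2 *
      volume (Metric.closedBall (0 : EuclideanSpace ℝ (Fin d)) (δ * r)) ≤
      ENNReal.ofReal ((2 * δ) ^ (d + 2)) * convEnergy D ε σ r w := by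
    rw [eLpNorm_two_sq_eq_lintegral, ← lintegral_mul_const' _ _ measure_closedBall_lt_top.ne]
    refine le_trans ?_ (lintegral_lintegral_sq_shift_le hD hwm hw hρ hT hε hσ hr hεδ hδ)
    rw [lintegral_lintegral_swap (Measurable.aemeasurable (by
      unfold Function.uncurry; fun_prop))]
    exact lintegral_mono fun x => sub_ballAverage_sq_mul_le (by positivity) hw x
  have hδd : ENNReal.ofReal (δ ^ d) ≠ 0 := by
    rw [ne_eq, ENNReal.ofReal_eq_zero, not_le]; positivity
  rw [hvol] at h1
  rw [← mul_div_assoc, ENNReal.le_div_iff_mul_le (Or.inl hB0) (Or.inl hBt)]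
  -- The volume of the small ball absorbs `δ ^ d`, leaving the gain `δ ^ 2`.
  refine (ENNReal.mul_le_mul_iff_left hδd ENNReal.ofReal_ne_top).1 ?_
  refine le_trans (le_of_eq ?_) (h1.trans (le_of_eq ?_))
  · ring
  · rw [mul_pow, pow_add δ, ENNReal.ofReal_mul (by positivity), ENNReal.ofReal_mul (by positivity)]
    ring

/-- As a pairing with a fixed `L²` function, the average at a point passes to weak limits. -/
theorem ballAverage_eq_integral_indicator {R : ℝ} {w : EuclideanSpace ℝ (Fin d) → ℝ}
    {x : EuclideanSpace ℝ (Fin d)} (hx : Metric.closedBall x R ⊆ D) :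
    ballAverage R w x = (volume.real (Metric.closedBall (0 : EuclideanSpace ℝ (Fin d)) R))⁻¹ *
      ∫ y in D, w y * (Metric.closedBall x R).indicator (fun _ => 1) y := by
  rw [ballAverage, setAverage_eq, smul_eq_mul]
  congr 1
  have hpre : (fun h => x + h) ⁻¹' Metric.closedBall x R = Metric.closedBall 0 R := by
    ext h
    simp
  rw [← hpre, (measurePreserving_add_left volume x).setIntegral_preimage_emb
    (measurableEmbedding_addLeft x), ← integral_indicator Metric.isClosed_closedBall.measurableSet,
    setIntegral_eq_integral_of_forall_compl_eq_zero fun y hy => by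
      rw [Set.indicator_of_notMem fun h => hy (hx h), mul_zero]]
  refine integral_congr_ae (.of_forall fun y => ?_)
  by_cases hy : y ∈ Metric.closedBall x R <;> simp [Set.indicator, hy]

/-- The bound is uniform in `x` and depends on `w` only through `M`, as bounded convergence
requires. -/
theorem abs_ballAverage_le {R : ℝ} {w : EuclideanSpace ℝ (Fin d) → ℝ} (hw : MemLp w 2 volume)
    {M : ℝ≥0} (hM : eLpNorm w 2 volume ≤ M) (x : EuclideanSpace ℝ (Fin d)) :
    |ballAverage R w x| ≤ (volume.real (Metric.closedBall (0 : EuclideanSpace ℝ (Fin d)) R))⁻¹ *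
      (M * (eLpNorm (fun _ => (1 : ℝ)) 2 (volume.restrict
        (Metric.closedBall (0 : EuclideanSpace ℝ (Fin d)) R))).toReal) := by
  set B := Metric.closedBall (0 : EuclideanSpace ℝ (Fin d)) R
  have hfin : IsFiniteMeasure (volume.restrict B) :=
    ⟨by rw [Measure.restrict_apply_univ]; exact measure_closedBall_lt_top⟩
  rw [ballAverage, setAverage_eq, smul_eq_mul, abs_mul, abs_of_nonneg (by positivity)]
  gcongr
  have h1 := abs_integral_mul_le_eLpNorm ((memLp_add_left hw x).restrict B)
    (memLp_const (1 : ℝ))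
  simp only [mul_one] at h1
  refine h1.trans ?_
  gcongr
  refine ENNReal.toReal_le_coe_of_le_coe (le_trans ?_ hM)
  refine (eLpNorm_mono_measure _ Measure.restrict_le_self).trans (le_of_eq ?_)
  exact eLpNorm_comp_measurePreserving hw.1 (measurePreserving_add_left volume x)

/-- Weakly convergent sequences with bounded convolution energies converge strongly in `L²` on
compactly contained subsets. -/
theorem tendsto_eLpNorm_sub_of_tendstoWeakL2 (hD : IsOpen D)
    {w : ℕ → EuclideanSpace ℝ (Fin d) → ℝ} (hwm : ∀ n, StronglyMeasurable (w n))
    (hw : ∀ n, MemLp (w n) 2 volume) {M : ℝ≥0} (hM : ∀ n, eLpNorm (w n) 2 volume ≤ M)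
    {e : ℕ → ℝ} (he : ∀ n, 0 < e n) (he0 : Tendsto e atTop (𝓝 0)) {k r : ℝ} (hr : 0 < r)
    {C : ℝ≥0} (hC : ∀ n, convEnergy D (e n) (k * e n) r (w n) ≤ C)
    {u : EuclideanSpace ℝ (Fin d) → ℝ} (hu : MemLp u 2 (volume.restrict D))
    (hweak : TendstoWeakL2 (volume.restrict D) w u) {T : Set (EuclideanSpace ℝ (Fin d))}
    (hT : MeasurableSet T) (hTD : CompactlyContained T D) :
    Tendsto (fun n => eLpNorm (w n - u) 2 (volume.restrict T)) atTop (𝓝 0) := by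
  have : IsFiniteMeasure (volume.restrict T) := ⟨by
    rw [Measure.restrict_apply_univ]
    exact (measure_mono subset_closure).trans_lt hTD.1.measure_lt_top⟩
  obtain ⟨ρ, hρ, hball⟩ := exists_pos_forall_closedBall_subset hD hTD.1 hTD.2
  have hTρ : ∀ x ∈ T, ∀ a, ‖a‖ ≤ ρ → Metric.closedBall (x + a) ρ ⊆ D :=
    fun x hx => hball x (subset_closure hx)
  have hwT : ∀ n, MemLp (w n) 2 (volume.restrict T) := fun n => (hw n).restrict T
  -- One function `a` eventually close to all `w n`, for every tolerance, is enough for the Cauchy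
  -- property.
  have happrox : ∀ η : ℝ≥0∞, 0 < η → ∃ a : EuclideanSpace ℝ (Fin d) → ℝ,
      AEStronglyMeasurable a (volume.restrict T) ∧
      ∀ᶠ n in atTop, eLpNorm (w n - a) 2 (volume.restrict T) < η := by
    intro η hη
    set A : ℝ≥0∞ := ENNReal.ofReal (2 ^ (d + 2)) * C /
      volume (Metric.closedBall (0 : EuclideanSpace ℝ (Fin d)) r)
    have hA : A ≠ ⊤ := ENNReal.div_ne_top
      (ENNReal.mul_ne_top ENNReal.ofReal_ne_top ENNReal.coe_ne_top)
      (Metric.measure_closedBall_pos volume _ hr).ne'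
    have hη2 : 0 < (η / 2) ^ 2 :=
      ENNReal.pow_pos (ENNReal.div_pos hη.ne' (by norm_num)) 2
    have hlimδ : Tendsto (fun δ : ℝ => ENNReal.ofReal (δ ^ 2) * A) (𝓝[>] 0) (𝓝 0) := by
      have h1 : Tendsto (fun δ : ℝ => ENNReal.ofReal (δ ^ 2)) (𝓝 0) (𝓝 0) := by
        have : Continuous fun δ : ℝ => ENNReal.ofReal (δ ^ 2) :=
          ENNReal.continuous_ofReal.comp (continuous_pow 2)
        simpa using this.tendsto 0
      have h2 := ENNReal.Tendsto.mul_const h1 (Or.inr hA)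
      rw [zero_mul] at h2
      exact h2.mono_left nhdsWithin_le_nhds
    have hlimr : Tendsto (fun δ : ℝ => δ * r) (𝓝[>] 0) (𝓝 0) := by
      have h1 : Tendsto (fun δ : ℝ => δ * r) (𝓝 0) (𝓝 (0 * r)) := tendsto_id.mul_const r
      rw [zero_mul] at h1
      exact h1.mono_left nhdsWithin_le_nhds
    -- `δ` makes the averaging error less than `η / 2` and keeps the balls around `T` inside `D`.
    obtain ⟨δ, ⟨hδA, hδρ⟩, hδ⟩ := (((hlimδ.eventually_lt_const hη2).and
      (hlimr.eventually_lt_const hρ)).and self_mem_nhdsWithin).exists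
    replace hδ : 0 < δ := hδ
    set R := δ * r
    have hballR : ∀ x ∈ T, Metric.closedBall x R ⊆ D := fun x hx =>
      (Metric.closedBall_subset_closedBall hδρ.le).trans
        (by simpa using hTρ x hx 0 (by simpa using hρ.le))
    set a : EuclideanSpace ℝ (Fin d) → ℝ := fun x =>
      (volume.real (Metric.closedBall (0 : EuclideanSpace ℝ (Fin d)) R))⁻¹ *
        ∫ y in D, u y * (Metric.closedBall x R).indicator (fun _ => 1) y
    have hlim : ∀ᵐ x ∂(volume.restrict T),
        Tendsto (fun n => ballAverage R (w n) x) atTop (𝓝 (a x)) := by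
      filter_upwards [ae_restrict_mem hT] with x hx
      simp only [ballAverage_eq_integral_indicator (hballR x hx)]
      refine (hweak _ ?_).const_mul _
      exact (memLp_indicator_const 2 Metric.isClosed_closedBall.measurableSet 1
        (Or.inr measure_closedBall_lt_top.ne)).restrict D
    have hmeas : ∀ n, AEStronglyMeasurable (ballAverage R (w n)) (volume.restrict T) :=
      fun n => (stronglyMeasurable_ballAverage R (hwm n)).aestronglyMeasurable
    have ha := aestronglyMeasurable_of_tendsto_ae _ hmeas hlim
    have havg : Tendsto (fun n => eLpNorm (ballAverage R (w n) - a) 2 (volume.restrict T)) atTop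
        (𝓝 0) := by
      refine tendsto_eLpNorm_two_of_bounded hmeas (fun n => ?_) hlim
        (B := 2 * ((volume.real (Metric.closedBall (0 : EuclideanSpace ℝ (Fin d)) R))⁻¹ *
          (M * (eLpNorm (fun _ => (1 : ℝ)) 2 (volume.restrict
            (Metric.closedBall (0 : EuclideanSpace ℝ (Fin d)) R))).toReal)))
      filter_upwards [hlim] with x hx
      have h1 := le_of_tendsto hx.abs
        (.of_forall fun n => abs_ballAverage_le (R := R) (hw n) (hM n) x)
      have h2 := abs_ballAverage_le (R := R) (hw n) (hM n) x
      have h3 := abs_sub (ballAverage R (w n) x) (a x)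
      linarith
    refine ⟨a, ha, ?_⟩
    have hk : Tendsto (fun n => k * e n) atTop (𝓝 0) := by simpa using he0.const_mul k
    filter_upwards [havg.eventually_lt_const (ENNReal.half_pos hη.ne'),
      he0.eventually_lt_const hδ, hk.eventually_lt_const hρ] with n h1 h2 h3
    have h4 : eLpNorm (w n - ballAverage R (w n)) 2 (volume.restrict T) < η / 2 := by
      by_contra! hle
      refine absurd (pow_le_pow_left' hle 2) (not_le.2 (lt_of_le_of_lt ?_ hδA))
      refine (eLpNorm_sub_ballAverage_sq_le hD (hwm n) (hw n) hρ hTρ (he n) h3 hr h2.le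
        hδρ.le).trans ?_
      have h5 := hC n
      unfold A
      gcongr
    calc eLpNorm (w n - a) 2 (volume.restrict T)
        = eLpNorm ((w n - ballAverage R (w n)) + (ballAverage R (w n) - a)) 2
            (volume.restrict T) := by rw [sub_add_sub_cancel]
      _ ≤ _ := eLpNorm_add_le ((hwT n).1.sub (hmeas n)) ((hmeas n).sub ha) (by norm_num)
      _ < η / 2 + η / 2 := ENNReal.add_lt_add h4 h1
      _ = η := ENNReal.add_halves η
  have hcauchy : CauchySeq fun n => (hwT n).toLp (w n) := by
    refine EMetric.cauchySeq_iff.2 fun η hη => ?_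
    obtain ⟨a, ha, hev⟩ := happrox (η / 2) (ENNReal.half_pos hη.ne')
    obtain ⟨N, hN⟩ := eventually_atTop.1 hev
    refine ⟨N, fun m hm n hn => ?_⟩
    rw [Lp.edist_toLp_toLp]
    calc eLpNorm (w m - w n) 2 (volume.restrict T)
        = eLpNorm ((w m - a) - (w n - a)) 2 (volume.restrict T) := by rw [sub_sub_sub_cancel_right]
      _ ≤ _ := eLpNorm_sub_le ((hwT m).1.sub ha) ((hwT n).1.sub ha) (by norm_num)
      _ < η / 2 + η / 2 := ENNReal.add_lt_add (hN m hm) (hN n hn)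
      _ = η := ENNReal.add_halves η
  obtain ⟨v, hv⟩ := cauchySeq_tendsto_of_complete hcauchy
  have hv' : Tendsto (fun n => eLpNorm (w n - (v : EuclideanSpace ℝ (Fin d) → ℝ)) 2
      (volume.restrict T)) atTop (𝓝 0) := by
    have h1 := (Lp.tendsto_Lp_iff_tendsto_eLpNorm' _ v).1 hv
    refine h1.congr fun n => eLpNorm_congr_ae ?_
    exact ((hwT n).coeFn_toLp).sub .rfl
  -- The strong limit on `T` can only be the weak limit `u`.
  have hvu := hweak.ae_eq_of_tendsto hT hTD.subset (fun n => (hw n).restrict D) hu (Lp.memLp v) hv'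
  refine hv'.congr fun n => eLpNorm_congr_ae ?_
  exact EventuallyEq.rfl.sub hvu

end Compactness

/-! ### Subsequences converging locally to `H¹` functions. -/

section Conclusion

variable {d : ℕ} {D : Set (EuclideanSpace ℝ (Fin d))}

theorem MemH1.congr_ae {u v : EuclideanSpace ℝ (Fin d) → ℝ} (hu : MemH1 D u)
    (huv : u =ᵐ[volume.restrict D] v) : MemH1 D v := by
  refine ⟨hu.1.ae_eq huv, fun i => ?_⟩
  obtain ⟨g, hg, hgw⟩ := hu.2 i
  refine ⟨g, hg, fun φ h1 h2 h3 => ?_⟩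
  rw [← hgw φ h1 h2 h3]
  exact integral_congr_ae (huv.mono fun x hx => by simp only [hx])

/-- Functions that agree almost everywhere on all compactly contained open subsets of `D` agree
almost everywhere on `D`. -/
theorem ae_eq_of_forall_compactlyContained (hD : IsOpen D) {u v : EuclideanSpace ℝ (Fin d) → ℝ}
    (h : ∀ T, IsOpen T → CompactlyContained T D → u =ᵐ[volume.restrict T] v) :
    u =ᵐ[volume.restrict D] v := by
  refine (ae_restrict_iff' hD.measurableSet).2 (ae_iff.2 ?_)
  refine measure_null_of_locally_null _ fun x hx => ?_
  have hxD : x ∈ D := by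
    by_contra hxD
    exact hx fun h => absurd h hxD
  obtain ⟨ρ, hρ, hball⟩ := Metric.nhds_basis_closedBall.mem_iff.1 (hD.mem_nhds hxD)
  have hsub : closure (Metric.ball x ρ) ⊆ Metric.closedBall x ρ :=
    Metric.closure_ball_subset_closedBall
  have hT := h (Metric.ball x ρ) Metric.isOpen_ball
    ⟨(isCompact_closedBall x ρ).of_isClosed_subset isClosed_closure hsub, hsub.trans hball⟩
  have hT' := ae_iff.1 ((ae_restrict_iff' Metric.isOpen_ball.measurableSet).1 hT)
  refine ⟨_, inter_mem_nhdsWithin _ (Metric.ball_mem_nhds x hρ), measure_mono_null ?_ hT'⟩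
  exact fun y hy h' => hy.1 fun _ => h' hy.2

/-- Sequences bounded in `L²(D)` with bounded convolution energies have subsequences converging
in `L²_loc(D)` to a function in `H¹(D)`. -/
theorem exists_subseq_tendsto_memH1 (hD : IsOpen D) {w : ℕ → EuclideanSpace ℝ (Fin d) → ℝ}
    (hw : ∀ n, MemLp (w n) 2 (volume.restrict D)) {M : ℝ≥0}
    (hM : ∀ n, eLpNorm (w n) 2 (volume.restrict D) ≤ M) {e : ℕ → ℝ} (he : ∀ n, 0 < e n)
    (he0 : Tendsto e atTop (𝓝 0)) {k r : ℝ} (hr : 0 < r) {C : ℝ≥0}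
    (hC : ∀ n, convEnergy D (e n) (k * e n) r (w n) ≤ C) :
    ∃ φ : ℕ → ℕ, StrictMono φ ∧ ∃ u, MemH1 D u ∧
      ∀ T, MeasurableSet T → CompactlyContained T D →
        Tendsto (fun n => eLpNorm (w (φ n) - u) 2 (volume.restrict T)) atTop (𝓝 0) := by
  -- Representatives vanishing off `D` allow translations on the whole space without changing norms
  -- or energies.
  choose W hWm hWL hWnorm hWae hW0 hWC using
    fun n => exists_stronglyMeasurable_representative hD (hw n)
  have hWM : ∀ n, eLpNorm (W n) 2 volume ≤ M := fun n => (hWnorm n).trans_le (hM n)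
  have hWC' : ∀ n, convEnergy D (e n) (k * e n) r (W n) ≤ C := fun n => by
    rw [hWC n _ _ _ (he n).ne']
    exact hC n
  obtain ⟨φ, hφ, u, hu, hweak⟩ := exists_subseq_tendstoWeakL2 (fun n => (hWL n).restrict D)
    fun n => (eLpNorm_mono_measure _ Measure.restrict_le_self).trans (hWM n)
  have heφ := he0.comp hφ.tendsto_atTop
  refine ⟨φ, hφ, u, ?_, fun T hT hTD => ?_⟩
  · exact memH1_of_tendstoWeakL2 hD (fun n => hWm _) (fun n => hWL _) (fun n => hW0 _)
      (fun n => (eLpNorm_mono_measure _ Measure.restrict_le_self).trans (hWM _))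
      (fun n => he (φ n)) heφ hr (fun n => hWC' (φ n)) hu hweak
  · refine (tendsto_eLpNorm_sub_of_tendstoWeakL2 hD (fun n => hWm _) (fun n => hWL _)
      (fun n => hWM _) (fun n => he (φ n)) heφ hr (fun n => hWC' (φ n)) hu hweak hT hTD).congr
      fun n => eLpNorm_congr_ae ?_
    have h : w (φ n) =ᵐ[volume.restrict T] W (φ n) :=
      ae_restrict_of_ae_restrict_of_subset hTD.subset (hWae (φ n))
    exact h.symm.sub .rfl

end Conclusion

/-! ### Relative compactness and limit points. -/

theorem theorem3p1 {d : ℕ} (D : Set (EuclideanSpace ℝ (Fin d))) (hD : IsOpen D)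
    (hLip : HasLipschitzBoundary D)
    (w : ℝ → EuclideanSpace ℝ (Fin d) → ℝ)
    (hw : ∀ ε : ℝ, 0 < ε → MemLp (w ε) 2 (volume.restrict D))
    (hbdd : ∃ M : ℝ≥0, ∀ ε : ℝ, 0 < ε → eLpNorm (w ε) 2 (volume.restrict D) ≤ M)
    (k r : ℝ) (hk : 0 < k) (hr : 0 < r)
    (henergy : ∃ C : ℝ≥0, ∀ ε : ℝ, 0 < ε → convEnergy D ε (k * ε) r (w ε) ≤ C)
    (ε : ℕ → ℝ) (hε : ∀ j, 0 < ε j) (hε0 : Tendsto ε atTop (𝓝 0)) :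
    -- relative compactness in `L²(D')`, and every limit point extends to an element of `H¹(D)`
    (∀ (D' : Set (EuclideanSpace ℝ (Fin d))) (_ : IsOpen D') (hD' : CompactlyContained D' D),
      IsCompact (closure (Set.range fun j => restrictL2 (hw (ε j) (hε j)) hD'.subset)) ∧
      ∀ v : Lp ℝ 2 (volume.restrict D'),
        MapClusterPt v atTop (fun j => restrictL2 (hw (ε j) (hε j)) hD'.subset) →
        ∃ u : EuclideanSpace ℝ (Fin d) → ℝ, MemH1 D u ∧ v =ᵐ[volume.restrict D'] u) ∧
    -- every limit of a subsequence in `L²_loc(D)` is in `H¹(D)`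
    (∀ u : EuclideanSpace ℝ (Fin d) → ℝ,
      (∀ D' : Set (EuclideanSpace ℝ (Fin d)), IsOpen D' → CompactlyContained D' D →
        MemLp u 2 (volume.restrict D')) →
      (∃ s : ℕ → ℕ, StrictMono s ∧
        ∀ D' : Set (EuclideanSpace ℝ (Fin d)), IsOpen D' → CompactlyContained D' D →
          Tendsto (fun j => eLpNorm (w (ε (s j)) - u) 2 (volume.restrict D')) atTop (𝓝 0)) →
      MemH1 D u) := by
  obtain ⟨M, hM⟩ := hbdd
  obtain ⟨C, hC⟩ := henergy
  -- The subsequence and `u` serve all `T` at once, so limits on each `T` are restrictions of a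
  -- function on `D`. `ψ` need not be monotone, which matches the compactness criterion.
  have hsub : ∀ ψ : ℕ → ℕ, Tendsto ψ atTop atTop → ∃ φ : ℕ → ℕ, StrictMono φ ∧
      ∃ u, ∃ hu : MemH1 D u, ∀ (T) (_ : IsOpen T) (hT : CompactlyContained T D),
        Tendsto (fun n => restrictL2 (hw (ε (ψ (φ n))) (hε _)) hT.subset) atTop
          (𝓝 (restrictL2 hu.1 hT.subset)) := by
    intro ψ hψ
    obtain ⟨φ, hφ, u, hu, h⟩ := exists_subseq_tendsto_memH1 hD (w := fun n => w (ε (ψ n)))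
      (fun n => hw _ (hε _)) (fun n => hM _ (hε _)) (fun n => hε (ψ n)) (hε0.comp hψ) hr
      (fun n => hC _ (hε _))
    exact ⟨φ, hφ, u, hu, fun T hTo hT =>
      (Lp.tendsto_Lp_iff_tendsto_eLpNorm'' _ _ _ _).2 (h T hTo.measurableSet hT)⟩
  refine ⟨fun D' hD'o hD' => ⟨?_, fun v hv => ?_⟩, fun u hu ⟨s, hs, hlim⟩ => ?_⟩
  · refine isCompact_closure_range_of_subseq fun ψ hψ => ?_
    obtain ⟨φ, hφ, u, hu, h⟩ := hsub ψ hψ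
    exact ⟨φ, hφ, _, h D' hD'o hD'⟩
  · obtain ⟨ψ, hψ, hψv⟩ := hv.tendsto_subseq
    obtain ⟨φ, hφ, u, hu, h⟩ := hsub ψ hψ.tendsto_atTop
    have hvu := tendsto_nhds_unique (hψv.comp hφ.tendsto_atTop) (h D' hD'o hD')
    refine ⟨u, hu, ?_⟩
    rw [hvu]
    exact MemLp.coeFn_toLp _
  · obtain ⟨φ, hφ, u', hu', h⟩ := hsub s hs.tendsto_atTop
    -- `u` is only known to be locally square integrable; agreeing almost everywhere with `u'` on
    -- `D` supplies the global bounds.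
    refine hu'.congr_ae (ae_eq_of_forall_compactlyContained hD fun T hTo hT => ?_)
    have h1 : Tendsto (fun n => restrictL2 (hw (ε (s (φ n))) (hε _)) hT.subset) atTop
        (𝓝 ((hu T hTo hT).toLp u)) :=
      (Lp.tendsto_Lp_iff_tendsto_eLpNorm'' _ _ _ _).2 ((hlim T hTo hT).comp hφ.tendsto_atTop)
    exact (MemLp.toLp_eq_toLp_iff _ _).1 (tendsto_nhds_unique (h T hTo hT) h1)
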